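/- Let $p$ be a prime, $E$ a finite extension of $\mathbf{Q}_p$ with ring of integers $\mathcal{O}$ and residue field $\mathbf{F}$. Let $A$ be a reduced complete Noetherian local $\mathcal{O}$-algebra with maximal ideal $\mathfrak{m}$ and residue field $\mathbf{F}$ which is finite over $\mathcal{O}$, and let $\mathcal{F}$ be its total ring of fractions, a finite product of fields $\prod_i A_i$. Let $G$ be a group, let $\tau_j : G \to \mathrm{GL}_{n_j}(\mathbf{F})$ ($j=1,2$) be absolutely irreducible representations with $\tau_1 \not\cong \tau_2$, put $n = n_1+n_2$ and assume that $n!$ is invertible in $A$. For $(i,j)\in\{(1,2),(2,1)\}$ fix one-dimensional subspaces $S_{ij} \subset \mathrm{Ext}^1_{\mathbf{F}[G]}(\tau_i,\tau_j)$. Let $\rho : A[G] \to M_n(A)$ be an $A$-algebra homomorphism whose reduction modulo $\mathfrak{m}$ has the form $\overline{\rho} = \begin{pmatrix} \tau_1 & * \\ 0 & \tau_2\end{pmatrix}$ and whose class in $\mathrm{Ext}^1_{\mathbf{F}[G]}(\tau_2,\tau_1)$ is a non-zero element of $S_{21}$. Assume that for every $i$ the pseudo-representation $A[G] \to A_i$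 obtained from $\mathrm{tr}\,\rho$ is absolutely irreducible, i.e. over an algebraic closure of $A_i$ it is not a sum of two pseudo-representations of positive dimension. (A pseudo-representation of dimension $d$ with values in $B$, where $d!\in B^\times$, is an $A$-linear map $T: A[G]\to B$ with $T(xy)=T(yx)$, $T(1)=d$ and $\sum_{\sigma\in S_{d+1}}\mathrm{sgn}(\sigma)T^\sigma(x_0,\dots,x_d)=0$, where $T^\sigma$ is the product over the cycles $(i_1\,\dots\,i_r)$ of $\sigma$ of $T(x_{i_1}\cdots x_{i_r})$.) Let $I$ be the ideal of reducibility of $\rho$: the smallest ideal $J \subseteq \mathfrak{m}$ of $A$ such that $\mathrm{tr}\,\rho \equiv T_1+T_2 \pmod J$ for pseudo-representations $T_j : A[G] \to A/J$ of dimension $n_j$ with $T_j \equiv \mathrm{tr}\,\tau_j \pmod{\mathfrak{m}}$. By an Urban lattice for $\rho$ we mean an $A$-lattice $\mathcal{L}$ in $\mathcal{F}^n$ (a finitely generated $A$-submodule spanning $\mathcal{F}^n$ over $\mathcal{F}$) which is stable under $\rho(G)$ and has no quotient isomorphic to $\tau_2$, an $A$-lattice $\mathcal{T}$ in $\mathcal{F}$,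 and an exact sequence of $\mathbf{F}[G]$-modules $$0 \to \tau_2 \otimes \mathcal{T}/\mathfrak{m}\mathcal{T} \to \mathcal{L}\otimes_A \mathbf{F} \to \tau_1 \to 0.$$ Writing $c \in \mathrm{Ext}^1_{\mathbf{F}[G]}(\tau_1, \tau_2\otimes \mathcal{T}/\mathfrak{m}\mathcal{T})$ for its class, let $$\iota : \mathrm{Hom}_{\mathbf{F}}(\mathcal{T}/\mathfrak{m}\mathcal{T}, \mathbf{F}) \to \mathrm{Ext}^1_{\mathbf{F}[G]}(\tau_1,\tau_2), \qquad f \mapsto (1\otimes f)_*(c).$$ Then the smallest ideal $I$ exists, Urban lattices for $\rho$ exist, and for every Urban lattice the map $\iota$ is injective and, if the image of $\iota$ lies in $S_{12}$, then $I$ is principal. -/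

import Mathlib

universe u

open scoped TensorProduct MonoidAlgebra

noncomputable section

namespace RedIdeal

/-! ### Pseudo-representations -/

/-- For a permutation `σ` of the indices and elements `x i` of an `A`-algebra `R`, the product
over all cycles `(i₁ i₂ … iᵣ)` of `σ` (fixed points included) of `T (x i₁ * x i₂ * ⋯ * x iᵣ)`.
The cycle is read off starting from its smallest index `i₁`; for central `T` the starting point
does not matter. -/
def cycleProd {A R B : Type*} [CommRing A] [Ring R] [Algebra A R] [CommRing B] [Algebra A B]
    (T : R →ₗ[A] B) {N : ℕ} (σ : Equiv.Perm (Fin N)) (x : Fin N → R) : B :=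
  open Classical in
  ∏ i ∈ Finset.univ.filter (fun i : Fin N => ∀ j, σ.SameCycle i j → i ≤ j),
    T ((List.range (Function.minimalPeriod σ i)).map (fun m => x ((σ ^ m) i))).prod

/-- `T : R → B` is a pseudo-representation (pseudo-character) of dimension `d` of the `A`-algebra
`R` with values in the commutative `A`-algebra `B`: an `A`-linear map with `T (x y) = T (y x)`,
with `T 1 = d`, satisfying the `d`-dimensional pseudo-character identity
`∑_{σ ∈ S_{d+1}} sgn(σ) T^σ(x₀, …, x_d) = 0`, where `d!` is invertible in `B`. -/
structure IsPseudorep {A R B : Type*} [CommRing A] [Ring R] [Algebra A R] [CommRing B]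
    [Algebra A B] (T : R →ₗ[A] B) (d : ℕ) : Prop where
  factorial_isUnit : IsUnit ((Nat.factorial d : ℕ) : B)
  central : ∀ x y : R, T (x * y) = T (y * x)
  map_one : T 1 = (d : B)
  frobenius : ∀ x : Fin (d + 1) → R,
    ∑ σ : Equiv.Perm (Fin (d + 1)), ((Equiv.Perm.sign σ : ℤ) : B) * cycleProd T σ x = 0

/-- A pseudo-representation `T` with values in a field `K` is absolutely irreducible if over an
algebraic closure of `K` it is not the sum of two pseudo-representations of positive dimension. -/
def IsAbsIrreduciblePseudorep {A R K : Type*} [CommRing A] [Ring R] [Algebra A R] [Field K]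
    [Algebra A K] (T : R →ₗ[A] K) : Prop :=
  ¬ ∃ (d₁ d₂ : ℕ) (T₁ T₂ : R →ₗ[A] AlgebraicClosure K), 0 < d₁ ∧ 0 < d₂ ∧
      IsPseudorep T₁ d₁ ∧ IsPseudorep T₂ d₂ ∧
      ∀ x, algebraMap K (AlgebraicClosure K) (T x) = T₁ x + T₂ x

/-! ### Matrix representations of a group -/

section Representations

variable {G : Type u} [Group G] {k : Type u} [Field k]

/-- The representation of `G` on column vectors given by a homomorphism `G → GL_n(k)`. -/
def vecRep {G k : Type*} [Group G] [CommRing k] {n : ℕ} (τ : G →* GL (Fin n) k) :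
    Representation k G (Fin n → k) :=
  (Matrix.toLinAlgEquiv' : Matrix (Fin n) (Fin n) k ≃ₐ[k] _).toAlgHom.toMonoidHom.comp
    ((Units.coeHom _).comp τ)

/-- `τ` is absolutely irreducible: it is irreducible over an algebraic closure of `k`. -/
def IsAbsIrreducible {n : ℕ} (τ : G →* GL (Fin n) k) : Prop :=
  (vecRep ((Matrix.GeneralLinearGroup.map (algebraMap k (AlgebraicClosure k))).comp τ)).IsIrreducible

/-! ### Extension classes in `Ext¹` over the group algebra -/

/-- A representation of `G` over `k` as a `k[G]`-module. -/
abbrev toMod {V : Type u} [AddCommGroup V] [Module k V] (σ : Representation k G V) :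
    ModuleCat.{u} k[G] :=
  ModuleCat.of k[G] σ.asModule

/-- `Ext¹_{k[G]}(σ, σ')`, a `k`-vector space. -/
abbrev ExtOne {V V' : Type u} [AddCommGroup V] [Module k V] [AddCommGroup V'] [Module k V']
    (σ : Representation k G V) (σ' : Representation k G V') : Type u :=
  CategoryTheory.Abelian.Ext.{u} (toMod σ) (toMod σ') 1

/-- A `G`-equivariant `k`-linear map as a morphism of `k[G]`-modules. -/
abbrev toModHom {V V' : Type u} [AddCommGroup V] [Module k V] [AddCommGroup V'] [Module k V']
    {σ : Representation k G V} {σ' : Representation k G V'} (f : σ.IntertwiningMap σ') :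
    toMod σ ⟶ toMod σ' :=
  ModuleCat.ofHom (Representation.IntertwiningMap.equivLinearMapAsModule σ σ' f)

variable {V₁ V V₂ : Type u} [AddCommGroup V₁] [Module k V₁] [AddCommGroup V] [Module k V]
  [AddCommGroup V₂] [Module k V₂] {σ₁ : Representation k G V₁} {σ : Representation k G V}
  {σ₂ : Representation k G V₂}

/-- The sequence `0 → σ₁ → σ → σ₂ → 0` is exact. -/
structure IsShortExact (i : σ₁.IntertwiningMap σ) (q : σ.IntertwiningMap σ₂) : Prop where
  injective : Function.Injective i
  exact : Function.Exact i q
  surjective : Function.Surjective q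

/-- The complex of `k[G]`-modules underlying an exact sequence of representations. -/
def IsShortExact.complex {i : σ₁.IntertwiningMap σ} {q : σ.IntertwiningMap σ₂}
    (h : IsShortExact i q) : CategoryTheory.ShortComplex (ModuleCat.{u} k[G]) :=
  CategoryTheory.ShortComplex.mk (toModHom i) (toModHom q) <| by
    ext x
    exact h.exact.apply_apply_eq_zero x

theorem IsShortExact.shortExact {i : σ₁.IntertwiningMap σ} {q : σ.IntertwiningMap σ₂}
    (h : IsShortExact i q) : h.complex.ShortExact where
  exact := by
    rw [CategoryTheory.ShortComplex.ShortExact.moduleCat_exact_iff_function_exact]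
    exact h.exact
  mono_f := (ModuleCat.mono_iff_injective _).2 h.injective
  epi_g := (ModuleCat.epi_iff_surjective _).2 h.surjective

/-- The class in `Ext¹_{k[G]}(σ₂, σ₁)` of an extension `0 → σ₁ → σ → σ₂ → 0`. -/
def IsShortExact.extClass {i : σ₁.IntertwiningMap σ} {q : σ.IntertwiningMap σ₂}
    (h : IsShortExact i q) : ExtOne σ₂ σ₁ :=
  h.shortExact.extClass

end Representations

/-! ### Representations over a local ring and their reduction -/

section Local

open IsLocalRing

variable {G : Type u} [Group G] {A : Type u} [CommRing A] [IsLocalRing A] {n₁ n₂ : ℕ}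

/-- The reduction of `ρ` modulo the maximal ideal, on column vectors over the residue field. -/
def redRep (ρ : A[G] →ₐ[A] Matrix (Fin n₁ ⊕ Fin n₂) (Fin n₁ ⊕ Fin n₂) A) :
    Representation (ResidueField A) G (Fin n₁ ⊕ Fin n₂ → ResidueField A) :=
  (Matrix.toLinAlgEquiv' : Matrix (Fin n₁ ⊕ Fin n₂) (Fin n₁ ⊕ Fin n₂) (ResidueField A)
      ≃ₐ[ResidueField A] _).toAlgHom.toMonoidHom.comp
    (((residue A).mapMatrix.toMonoidHom.comp ρ.toRingHom.toMonoidHom).comp (MonoidAlgebra.of A G))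

/-- The reduction of `ρ` is block upper triangular of the form `[[τ₁, *], [0, τ₂]]`. -/
def HasReduction (ρ : A[G] →ₐ[A] Matrix (Fin n₁ ⊕ Fin n₂) (Fin n₁ ⊕ Fin n₂) A)
    (τ₁ : G →* GL (Fin n₁) (ResidueField A)) (τ₂ : G →* GL (Fin n₂) (ResidueField A)) : Prop :=
  ∀ g : G, ∃ b : Matrix (Fin n₁) (Fin n₂) (ResidueField A),
    (ρ (MonoidAlgebra.of A G g)).map (residue A) =
      Matrix.fromBlocks (τ₁ g : Matrix (Fin n₁) (Fin n₁) (ResidueField A)) b 0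
        (τ₂ g : Matrix (Fin n₂) (Fin n₂) (ResidueField A))

section

variable {ρ : A[G] →ₐ[A] Matrix (Fin n₁ ⊕ Fin n₂) (Fin n₁ ⊕ Fin n₂) A}
  {τ₁ : G →* GL (Fin n₁) (ResidueField A)} {τ₂ : G →* GL (Fin n₂) (ResidueField A)}

/-- The inclusion `v ↦ (v, 0)` of `τ₁` in the reduction of `ρ`. -/
def HasReduction.incl (h : HasReduction ρ τ₁ τ₂) :
    (vecRep τ₁).IntertwiningMap (redRep ρ) where
  toFun v := Sum.elim v 0
  map_add' v w := by ext (i | i) <;> simp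
  map_smul' c v := by ext (i | i) <;> simp
  isIntertwining' g := by
    obtain ⟨b, hb⟩ := h g
    refine LinearMap.ext fun v => ?_
    change Sum.elim (Matrix.mulVec _ v) 0 =
      Matrix.mulVec ((ρ (MonoidAlgebra.of A G g)).map (residue A)) (Sum.elim v 0)
    rw [hb, Matrix.fromBlocks_mulVec]
    simp

/-- The projection `(v, w) ↦ w` of the reduction of `ρ` onto `τ₂`. -/
def HasReduction.proj (h : HasReduction ρ τ₁ τ₂) :
    (redRep ρ).IntertwiningMap (vecRep τ₂) where
  toFun v := v ∘ Sum.inr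
  map_add' _ _ := rfl
  map_smul' _ _ := rfl
  isIntertwining' g := by
    obtain ⟨b, hb⟩ := h g
    refine LinearMap.ext fun v => ?_
    change (Matrix.mulVec ((ρ (MonoidAlgebra.of A G g)).map (residue A)) v) ∘ Sum.inr =
      Matrix.mulVec _ (v ∘ Sum.inr)
    rw [hb, Matrix.fromBlocks_mulVec]
    simp

theorem HasReduction.isShortExact (h : HasReduction ρ τ₁ τ₂) : IsShortExact h.incl h.proj where
  injective v w hvw := funext fun i => congrFun hvw (Sum.inl i)
  exact v := by
    constructor
    · intro hv
      refine ⟨v ∘ Sum.inl, ?_⟩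
      funext i
      rcases i with i | i
      · rfl
      · exact (congrFun hv i).symm
    · rintro ⟨w, rfl⟩
      rfl
  surjective w := ⟨Sum.elim 0 w, rfl⟩

/-- The class of `0 → τ₁ → ρ mod 𝔪 → τ₂ → 0` in `Ext¹_{k[G]}(τ₂, τ₁)`. -/
def HasReduction.extClass (h : HasReduction ρ τ₁ τ₂) : ExtOne (vecRep τ₂) (vecRep τ₁) :=
  h.isShortExact.extClass

end

/-- The trace `tr ρ : A[G] → A`. -/
def traceMap (ρ : A[G] →ₐ[A] Matrix (Fin n₁ ⊕ Fin n₂) (Fin n₁ ⊕ Fin n₂) A) : A[G] →ₗ[A] A :=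
  (Matrix.traceLinearMap (Fin n₁ ⊕ Fin n₂) A A).comp ρ.toLinearMap

/-! ### The ideal of reducibility -/

/-- `T = T₁ + T₂` modulo the (proper) ideal `J`, for pseudo-representations `T₁`, `T₂` with values
in `A / J` such that `Tᵢ = tr τᵢ` modulo the maximal ideal. -/
def IsReducibleModulo (T : A[G] →ₗ[A] A) (τ₁ : G →* GL (Fin n₁) (ResidueField A))
    (τ₂ : G →* GL (Fin n₂) (ResidueField A)) (J : Ideal A) : Prop :=
  ∃ (hJ : J ≤ maximalIdeal A) (T₁ T₂ : A[G] →ₗ[A] A ⧸ J),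
    IsPseudorep T₁ n₁ ∧ IsPseudorep T₂ n₂ ∧
    (∀ x, Ideal.Quotient.mk J (T x) = T₁ x + T₂ x) ∧
    (∀ g, Ideal.Quotient.factor hJ (T₁ (MonoidAlgebra.of A G g)) =
      (Matrix.trace (τ₁ g : Matrix (Fin n₁) (Fin n₁) (ResidueField A)) : ResidueField A)) ∧
    (∀ g, Ideal.Quotient.factor hJ (T₂ (MonoidAlgebra.of A G g)) =
      (Matrix.trace (τ₂ g : Matrix (Fin n₂) (Fin n₂) (ResidueField A)) : ResidueField A))

/-- The ideal of reducibility of `T`: the infimum of all ideals modulo which `T` is reducible. -/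
def reducibilityIdeal (T : A[G] →ₗ[A] A) (τ₁ : G →* GL (Fin n₁) (ResidueField A))
    (τ₂ : G →* GL (Fin n₂) (ResidueField A)) : Ideal A :=
  sInf {J | IsReducibleModulo T τ₁ τ₂ J}

/-! ### Lattices -/

/-- The `A`-linear action of `G` through `ρ` on column vectors over the total ring of fractions. -/
def fracRep (ρ : A[G] →ₐ[A] Matrix (Fin n₁ ⊕ Fin n₂) (Fin n₁ ⊕ Fin n₂) A) :
    Representation A G (Fin n₁ ⊕ Fin n₂ → FractionRing A) where
  toFun g := (Matrix.toLin' ((ρ (MonoidAlgebra.of A G g)).map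
    (algebraMap A (FractionRing A)))).restrictScalars A
  map_one' := by
    refine LinearMap.ext fun v => ?_
    rw [map_one, map_one, Matrix.map_one _ (map_zero _) (map_one _), Matrix.toLin'_one]
    rfl
  map_mul' g h := by
    refine LinearMap.ext fun v => ?_
    simp only [map_mul, Matrix.map_mul, Matrix.toLin'_mul]
    rfl

/-- `σ ⊗_A k` for a representation `σ` over `A`, `k` the residue field of `A`. -/
def residualRep {V : Type u} [AddCommGroup V] [Module A V] (σ : Representation A G V) :
    Representation (ResidueField A) G (ResidueField A ⊗[A] V) :=
  (Module.End.baseChangeHom A (ResidueField A) V).toMonoidHom.comp σ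

/-- An `A`-lattice `L` in `Frac(A)^n`, stable under `ρ`, and an `A`-lattice `𝒯` in `Frac(A)`, with
an exact sequence of `k[G]`-modules `0 → τ₂ ⊗ 𝒯/𝔪𝒯 → L ⊗_A k → τ₁ → 0`, such that `L` has no
quotient isomorphic to `τ₂`. Here `𝒯/𝔪𝒯` is written as `k ⊗_A 𝒯`. -/
structure UrbanLattice (ρ : A[G] →ₐ[A] Matrix (Fin n₁ ⊕ Fin n₂) (Fin n₁ ⊕ Fin n₂) A)
    (τ₁ : G →* GL (Fin n₁) (ResidueField A)) (τ₂ : G →* GL (Fin n₂) (ResidueField A)) where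
  /-- the stable lattice in `Frac(A)^n` -/
  L : Subrepresentation (fracRep ρ)
  /-- the lattice in `Frac(A)` -/
  𝒯 : Submodule A (FractionRing A)
  isLattice_L : Submodule.IsLattice (FractionRing A) L.toSubmodule
  isLattice_𝒯 : Submodule.IsLattice (FractionRing A) 𝒯
  /-- the map `τ₂ ⊗ 𝒯/𝔪𝒯 → L ⊗_A k` -/
  incl : ((vecRep τ₂).tprod (Representation.trivial (ResidueField A) G
      (ResidueField A ⊗[A] 𝒯))).IntertwiningMap (residualRep L.toRepresentation)
  /-- the map `L ⊗_A k → τ₁` -/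
  proj : (residualRep L.toRepresentation).IntertwiningMap (vecRep τ₁)
  isShortExact : IsShortExact incl proj
  no_quotient : ¬ ∃ π : L.toSubmodule →ₗ[A] (Fin n₂ → ResidueField A),
    Function.Surjective π ∧ ∀ g v, π (L.toRepresentation g v) = vecRep τ₂ g (π v)

namespace UrbanLattice

variable {ρ : A[G] →ₐ[A] Matrix (Fin n₁ ⊕ Fin n₂) (Fin n₁ ⊕ Fin n₂) A}
  {τ₁ : G →* GL (Fin n₁) (ResidueField A)} {τ₂ : G →* GL (Fin n₂) (ResidueField A)}

/-- The map `1 ⊗ f : τ₂ ⊗ 𝒯/𝔪𝒯 → τ₂` for a linear form `f` on `𝒯/𝔪𝒯`. -/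
def contract (𝓛 : UrbanLattice ρ τ₁ τ₂)
    (f : Module.Dual (ResidueField A) (ResidueField A ⊗[A] 𝓛.𝒯)) :
    ((vecRep τ₂).tprod (Representation.trivial (ResidueField A) G
      (ResidueField A ⊗[A] 𝓛.𝒯))).IntertwiningMap (vecRep τ₂) where
  toLinearMap := (TensorProduct.rid (ResidueField A) (Fin n₂ → ResidueField A)).toLinearMap ∘ₗ
    f.lTensor (Fin n₂ → ResidueField A)
  isIntertwining' g := by
    refine TensorProduct.ext' fun v t => ?_
    simp

/-- `ι : Hom(𝒯/𝔪𝒯, k) → Ext¹_{k[G]}(τ₁, τ₂)`, sending `f` to the image under `1 ⊗ f` of the class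
`c ∈ Ext¹_{k[G]}(τ₁, τ₂ ⊗ 𝒯/𝔪𝒯)` of `0 → τ₂ ⊗ 𝒯/𝔪𝒯 → L ⊗_A k → τ₁ → 0`. -/
def ι (𝓛 : UrbanLattice ρ τ₁ τ₂)
    (f : Module.Dual (ResidueField A) (ResidueField A ⊗[A] 𝓛.𝒯)) :
    ExtOne (vecRep τ₁) (vecRep τ₂) :=
  𝓛.isShortExact.extClass.comp (CategoryTheory.Abelian.Ext.mk₀ (toModHom (𝓛.contract f)))
    (add_zero 1)

end UrbanLattice

end Local

end RedIdeal

end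

/-!
After a change of basis over `A`, the image of `A[G]` consists of all matrices whose lower left
`n₂ × n₁` block has its entries in some ideal `C` of `A`; everything is then read off from `C`.

*The image.* By the density theorem `A[G]` maps onto the product of the two residual matrix
algebras, so it has an element whose reduction is block upper triangular, with diagonal blocks
that are themselves diagonal with entries `0, 1, …, n - 1`. As `n!` is invertible, these entries
are distinct, so by Hensel's lemma the element can be diagonalized over `A`, and polynomials in it
give all diagonal idempotents. Hence the image is cut out by conditions on the single entries,
each given by an ideal. Density shows that these ideals are `A` in the two diagonal blocks, and
hence the same for all entries of the same block; in the upper right block it is `A`, since the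
extension class of the reduction is non-zero. What remains is the ideal `C` for the lower left
block (`exists_isStandard_conj`). As `tr ρ` is absolutely irreducible at each factor of the total
ring of fractions, `C` generates the unit ideal there (`map_fractionRing_eq_top`).

*The ideal of reducibility is `C`.* Modulo `C` the trace is the sum of the traces of the two
diagonal blocks. Conversely, let the trace be the sum of two pseudo-representations `T₁` and `T₂`
modulo `J`, and let `x` be the idempotent of the first block. An element `c` of `C` is the trace of
a product `x ^ r * a * (1 - x) ^ s * b`. The pseudo-character identity, evaluated at `(w, z, …, z)`,
shows that `T₁` is small on multiples of high powers of `1 - x`, where it is residually zero, and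
likewise `T₂` on those of `x` (`IsPseudorep.apply_pow_mul_mem`). So `c` is in all powers of the
maximal ideal modulo `J`, and Krull's intersection theorem gives `c ∈ J`
(`IsStandard.le_of_isReducibleModulo`).

*Urban lattices.* The lattice `A^n₁ × C^n₂` with `𝒯 = C` is an Urban lattice: it has no quotient
`τ₂` because it is generated by its first basis vector, through elements which act as zero on `τ₂`
(`stdUrbanLattice`). For any Urban lattice, if `ι f = 0` then `1 ⊗ f` extends to the reduction of
the lattice, and for `f ≠ 0` this would be a quotient `τ₂` (`UrbanLattice.ι_injective`).

*Principality.* If the image of `ι` lies in a line, `𝒯/𝔪𝒯` is at most one-dimensional, and so the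
reduction of the lattice has dimension at most `n₁ + n₂`. The lattice is the product of its
coordinate lattices, only two of which are different, so by Nakayama's lemma it is
`(A α)^n₁ × (A β)^n₂`. It is stable under `C` in the lower left block, so `C α ⊆ A β`; if this were
contained in `𝔪 β`, the second factor would give a quotient `τ₂`. Therefore `C α = A β`, and `C` is
principal (`UrbanLattice.isPrincipal`).
-/

noncomputable section

namespace RedIdeal

/-! ### Traces of matrices are pseudo-representations -/

section Trace

variable {m B : Type*} [Fintype m] [DecidableEq m] [CommRing B]

/-- An entry of a product of matrices is the sum over all paths of the products of the entries
along the path. -/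
theorem list_prod_apply_eq_sum_paths (l : ℕ) (y : Fin (l + 1) → Matrix m m B) (s t : m) :
    (List.ofFn y).prod s t = ∑ b : Fin l → m,
      ∏ k : Fin (l + 1), y k ((Fin.cons s b : Fin (l + 1) → m) k)
        ((Fin.snoc b t : Fin (l + 1) → m) k) := by
  induction l generalizing s with
  | zero => simp [Fin.snoc]
  | succ l ih =>
    rw [List.ofFn_succ, List.prod_cons, Matrix.mul_apply,
      ← (Fin.consEquiv (fun _ : Fin (l + 1) => m)).sum_comp, Fintype.sum_prod_type]
    refine Finset.sum_congr rfl fun v _ => ?_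
    rw [ih, Finset.mul_sum]
    refine Finset.sum_congr rfl fun b _ => ?_
    rw [Fin.prod_univ_succ (n := l + 1)]
    simp only [Fin.consEquiv, Equiv.coe_fn_mk, Fin.cons_succ, Fin.cons_zero]
    have h : (Fin.snoc (Fin.cons v b : Fin (l + 1) → m) t : Fin (l + 2) → m) =
        Fin.cons v (Fin.snoc b t : Fin (l + 1) → m) := (Fin.cons_snoc_eq_snoc_cons _ _ _).symm
    refine congrArg₂ (· * ·) ?_ (Finset.prod_congr rfl fun k _ => ?_)
    · exact congrArg (y 0 s) (congrFun h 0).symm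
    · exact congrArg (y k.succ _) (congrFun h k.succ).symm

/-- The trace of a product of matrices is the sum over all closed paths; here `k + 1` is cyclic in
`Fin (l + 1)`. -/
theorem trace_list_prod_eq_sum_loops (l : ℕ) (y : Fin (l + 1) → Matrix m m B) :
    (List.ofFn y).prod.trace = ∑ a : Fin (l + 1) → m, ∏ k, y k (a k) (a (k + 1)) := by
  rw [← (Fin.consEquiv (fun _ : Fin (l + 1) => m)).sum_comp, Fintype.sum_prod_type, Matrix.trace]
  refine Finset.sum_congr rfl fun s _ => ?_
  rw [Matrix.diag_apply, list_prod_apply_eq_sum_paths]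
  refine Finset.sum_congr rfl fun b _ => Finset.prod_congr rfl fun k _ => ?_
  simp only [Fin.consEquiv, Equiv.coe_fn_mk]
  congr 1
  induction k using Fin.lastCases with
  | last => simp
  | cast k => simp [Fin.coeSucc_eq_succ]

/-- The indices that are smallest in their cycle, as used in `cycleProd`. -/
def cycleReps {N : ℕ} (σ : Equiv.Perm (Fin N)) : Finset (Fin N) :=
  open Classical in Finset.univ.filter (fun i : Fin N => ∀ j, σ.SameCycle i j → i ≤ j)

theorem mem_cycleReps {N : ℕ} {σ : Equiv.Perm (Fin N)} {i : Fin N} :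
    i ∈ cycleReps σ ↔ ∀ j, σ.SameCycle i j → i ≤ j := by
  simp [cycleReps]

theorem minimalPeriod_perm_pos {N : ℕ} (σ : Equiv.Perm (Fin N)) (i : Fin N) :
    0 < Function.minimalPeriod σ i :=
  Function.minimalPeriod_pos_of_mem_periodicPts
    (Function.Injective.mem_periodicPts σ.injective i)

theorem exists_cycleReps_pow_eq {N : ℕ} (σ : Equiv.Perm (Fin N)) (i : Fin N) :
    ∃ r ∈ cycleReps σ, ∃ k < Function.minimalPeriod σ r, (σ ^ k) r = i := by
  classical
  have hne : (Finset.univ.filter fun j => σ.SameCycle i j).Nonempty :=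
    ⟨i, by simp [Equiv.Perm.SameCycle.refl]⟩
  obtain ⟨r, hr, hmin⟩ := Finset.exists_min_image _ id hne
  simp only [Finset.mem_filter, Finset.mem_univ, true_and, id] at hr hmin
  refine ⟨r, mem_cycleReps.2 fun j hj => hmin j (hr.trans hj), ?_⟩
  obtain ⟨k, hk⟩ := hr.symm.exists_nat_pow_eq
  refine ⟨k % Function.minimalPeriod σ r, Nat.mod_lt _ (minimalPeriod_perm_pos σ r), ?_⟩
  rw [← hk, ← Equiv.Perm.iterate_eq_pow, ← Equiv.Perm.iterate_eq_pow,
    Function.iterate_mod_minimalPeriod_eq]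

/-- Every index is reached exactly once by going around the cycles, starting at their smallest
elements. -/
def cycleEquiv {N : ℕ} (σ : Equiv.Perm (Fin N)) :
    (Σ r : cycleReps σ, Fin (Function.minimalPeriod σ r)) ≃ Fin N :=
  Equiv.ofBijective (fun q => (σ ^ (q.2 : ℕ)) (q.1 : Fin N)) <| by
    constructor
    · rintro ⟨⟨r, hr⟩, k⟩ ⟨⟨r', hr'⟩, k'⟩ h
      have hrr : r = r' := by
        have hs : σ.SameCycle r r' := by
          have h1 : σ.SameCycle r ((σ ^ (k : ℕ)) r) := ⟨k, by simp⟩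
          have h2 : σ.SameCycle r' ((σ ^ (k' : ℕ)) r') := ⟨k', by simp⟩
          have h' : (σ ^ (k : ℕ)) r = (σ ^ (k' : ℕ)) r' := h
          exact h1.trans (h' ▸ h2.symm)
        exact le_antisymm (mem_cycleReps.1 hr _ hs) (mem_cycleReps.1 hr' _ hs.symm)
      subst hrr
      simp only [← Equiv.Perm.iterate_eq_pow] at h
      have := (Function.iterate_eq_iterate_iff_of_lt_minimalPeriod k.2 k'.2).1 h
      obtain rfl : k = k' := Fin.ext this
      rfl
    · intro i
      obtain ⟨r, hr, k, hk, h⟩ := exists_cycleReps_pow_eq σ i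
      exact ⟨⟨⟨r, hr⟩, ⟨k, hk⟩⟩, h⟩

theorem apply_cycleEquiv {N : ℕ} (σ : Equiv.Perm (Fin N)) (r : cycleReps σ) (l : ℕ)
    (hl : Function.minimalPeriod σ r = l + 1) (k : Fin (l + 1)) :
    σ (cycleEquiv σ ⟨r, Fin.cast hl.symm k⟩) = cycleEquiv σ ⟨r, Fin.cast hl.symm (k + 1)⟩ := by
  change σ ((σ ^ (k : ℕ)) r) = (σ ^ ((k + 1 : Fin (l + 1)) : ℕ)) r
  rw [← Equiv.Perm.mul_apply, ← pow_succ', Fin.val_add_one]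
  split_ifs with h
  · rw [h, Fin.val_last, ← hl, ← Equiv.Perm.iterate_eq_pow, Function.iterate_minimalPeriod]
    rfl
  · rfl

variable {A R : Type*} [CommRing A] [Ring R] [Algebra A R] [Algebra A B]

/-- The trace of a matrix representation. -/
def matTrace (φ : R →ₐ[A] Matrix m m B) : R →ₗ[A] B :=
  (Matrix.traceLinearMap m A B).comp φ.toLinearMap

@[simp] theorem matTrace_apply (φ : R →ₐ[A] Matrix m m B) (x : R) :
    matTrace φ x = (φ x).trace := rfl

/-- For the trace of a matrix representation, the product over the cycles of `σ` is the sum over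
all families of indices `a` of the products of the entries at `(a i, a (σ i))`. -/
theorem cycleProd_matTrace (φ : R →ₐ[A] Matrix m m B) {N : ℕ} (σ : Equiv.Perm (Fin N))
    (x : Fin N → R) :
    cycleProd (matTrace φ) σ x = ∑ a : Fin N → m, ∏ i, φ (x i) (a i) (a (σ i)) := by
  classical
  have key : ∀ r : cycleReps σ, matTrace φ
      ((List.range (Function.minimalPeriod σ (r : Fin N))).map
        (fun j => x ((σ ^ j) (r : Fin N)))).prod =
      ∑ b : Fin (Function.minimalPeriod σ (r : Fin N)) → m,
        ∏ k, φ (x (cycleEquiv σ ⟨r, k⟩)) (b k)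
          (b ⟨((k : ℕ) + 1) % Function.minimalPeriod σ (r : Fin N),
            Nat.mod_lt _ (minimalPeriod_perm_pos σ r)⟩) := by
    intro r
    obtain ⟨l, hl⟩ := Nat.exists_eq_succ_of_ne_zero (minimalPeriod_perm_pos σ r).ne'
    rw [matTrace_apply, map_list_prod, List.map_map]
    have h1 : (List.range (Function.minimalPeriod σ (r : Fin N))).map
        (φ ∘ fun j => x ((σ ^ j) (r : Fin N))) =
        List.ofFn fun k : Fin (l + 1) => φ (x ((σ ^ (k : ℕ)) (r : Fin N))) := by
      rw [hl]
      refine List.ext_getElem (by simp) fun i h1 h2 => ?_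
      rw [List.getElem_map, List.getElem_range, List.getElem_ofFn]
      rfl
    rw [h1, trace_list_prod_eq_sum_loops]
    rw [← (Equiv.arrowCongr (finCongr hl) (Equiv.refl m)).sum_comp]
    refine Finset.sum_congr rfl fun b _ => ?_
    rw [← (finCongr hl).prod_comp]
    refine Finset.prod_congr rfl fun k _ => ?_
    simp only [Equiv.arrowCongr_apply, Function.comp_apply, Equiv.refl_apply,
      Equiv.symm_apply_apply]
    refine congrArg (φ (x ((σ ^ (k : ℕ)) (r : Fin N))) (b k)) (congrArg b (Fin.ext ?_))
    simp [Fin.val_add, hl]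
  calc cycleProd (matTrace φ) σ x
      = ∏ r ∈ cycleReps σ, matTrace φ
          ((List.range (Function.minimalPeriod σ r)).map (fun j => x ((σ ^ j) r))).prod := rfl
    _ = ∏ r : cycleReps σ, matTrace φ
          ((List.range (Function.minimalPeriod σ (r : Fin N))).map
            (fun j => x ((σ ^ j) (r : Fin N)))).prod :=
        (Finset.prod_coe_sort (cycleReps σ) (fun r => matTrace φ
          ((List.range (Function.minimalPeriod σ r)).map (fun j => x ((σ ^ j) r))).prod)).symm
    _ = ∑ a : Fin N → m, ∏ i, φ (x i) (a i) (a (σ i)) := by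
        simp_rw [key]
        rw [Finset.prod_univ_sum, Fintype.piFinset_univ]
        rw [← ((Equiv.arrowCongr (cycleEquiv σ) (Equiv.refl m)).symm.trans
          (Equiv.piCurry (fun _ _ => m))).sum_comp]
        refine Finset.sum_congr rfl fun a _ => ?_
        rw [← (cycleEquiv σ).prod_comp, Fintype.prod_sigma]
        refine Finset.prod_congr rfl fun r _ => Finset.prod_congr rfl fun k _ => ?_
        obtain ⟨l, hl⟩ := Nat.exists_eq_succ_of_ne_zero (minimalPeriod_perm_pos σ r).ne'
        have h2 := apply_cycleEquiv σ r l hl (Fin.cast hl k)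
        rw [show (Fin.cast hl.symm (Fin.cast hl k)) = k from rfl] at h2
        rw [h2]
        change _ = φ (x (cycleEquiv σ ⟨r, k⟩)) (a (cycleEquiv σ ⟨r, k⟩)) (a (cycleEquiv σ ⟨r, _⟩))
        refine congrArg (fun j => φ (x (cycleEquiv σ ⟨r, k⟩)) (a (cycleEquiv σ ⟨r, k⟩))
          (a (cycleEquiv σ ⟨r, j⟩))) (Fin.ext ?_)
        simp [Fin.val_add, hl]

/-- The trace of a `d`-dimensional matrix representation satisfies the `d`-dimensional
pseudo-character identity, as determinants of size `d + 1` in `d` letters have two equal rows. -/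
theorem isPseudorep_matTrace (φ : R →ₐ[A] Matrix m m B)
    (hd : IsUnit ((Nat.factorial (Fintype.card m) : ℕ) : B)) :
    IsPseudorep (matTrace φ) (Fintype.card m) where
  factorial_isUnit := hd
  central x y := by
    rw [matTrace_apply, map_mul, Matrix.trace_mul_comm, ← map_mul, matTrace_apply]
  map_one := by simp
  frobenius x := by
    simp_rw [cycleProd_matTrace, Finset.mul_sum]
    rw [Finset.sum_comm]
    refine Finset.sum_eq_zero fun a _ => ?_
    have hninj : ¬ Function.Injective a := fun h => by
      simpa using Fintype.card_le_of_injective a h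
    obtain ⟨i, j, haij, hij⟩ := Function.not_injective_iff.1 hninj
    have hdet := Matrix.det_apply (Matrix.of fun r c => φ (x c) (a c) (a r))
    rw [Matrix.det_zero_of_row_eq hij (by funext c; simp [haij])] at hdet
    rw [hdet]
    refine Finset.sum_congr rfl fun σ _ => ?_
    rw [Units.smul_def, zsmul_eq_mul]
    rfl

end Trace

/-! ### Nilpotency for pseudo-representations -/

section Nilpotency

theorem zero_mem_cycleReps {d : ℕ} (σ : Equiv.Perm (Fin (d + 1))) : 0 ∈ cycleReps σ :=
  mem_cycleReps.2 fun j _ => Fin.zero_le j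

theorem cycleReps_eq_singleton_iff {d : ℕ} (hd : 0 < d) (σ : Equiv.Perm (Fin (d + 1))) :
    cycleReps σ = {0} ↔ σ.cycleType = {d + 1} := by
  have : Nontrivial (Fin (d + 1)) := Fin.nontrivial_iff_two_le.2 (by omega)
  constructor
  · intro h
    have hs : ∀ i, σ.SameCycle 0 i := fun i => by
      obtain ⟨r, hr, k, -, hk⟩ := exists_cycleReps_pow_eq σ i
      rw [h, Finset.mem_singleton] at hr
      subst hr
      exact ⟨k, by simpa using hk⟩
    have hon : σ.IsCycleOn (Set.univ : Set (Fin (d + 1))) :=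
      ⟨σ.bijective.bijOn_univ, fun i _ j _ => (hs i).symm.trans (hs j)⟩
    have hne : ∀ i, σ i ≠ i := fun i => hon.apply_ne Set.nontrivial_univ (Set.mem_univ i)
    have hc : σ.IsCycle := ⟨0, hne 0, fun i _ => hs i⟩
    rw [hc.cycleType]
    have hsupp : σ.support = Finset.univ := Finset.eq_univ_iff_forall.2 fun i => by
      simpa using hne i
    rw [hsupp]
    simp
  · intro h
    have hc : σ.IsCycle := by
      rw [← Equiv.Perm.card_cycleType_eq_one, h, Multiset.card_singleton]
    have hsupp : σ.support = Finset.univ := by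
      rw [hc.cycleType, Multiset.singleton_inj] at h
      exact Finset.eq_univ_of_card _ (by simpa using h)
    refine Finset.eq_singleton_iff_unique_mem.2 ⟨zero_mem_cycleReps σ, fun i hi => ?_⟩
    have hi0 : σ.SameCycle i 0 := hc.sameCycle
      (Equiv.Perm.mem_support.1 (hsupp ▸ Finset.mem_univ i))
      (Equiv.Perm.mem_support.1 (hsupp ▸ Finset.mem_univ 0))
    exact le_antisymm (mem_cycleReps.1 hi 0 hi0) (Fin.zero_le i)

variable {A R B : Type*} [CommRing A] [Ring R] [Algebra A R] [CommRing B] [Algebra A B]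

/-- The product over the cycles of `σ`, evaluated at `(w, z, …, z)`. -/
theorem cycleProd_cons_const (T : R →ₗ[A] B) {d : ℕ} (σ : Equiv.Perm (Fin (d + 1))) (w z : R) :
    cycleProd T σ (Fin.cons w fun _ => z : Fin (d + 1) → R) =
      T (w * z ^ (Function.minimalPeriod σ 0 - 1)) *
        ∏ r ∈ (cycleReps σ).erase 0, T (z ^ Function.minimalPeriod σ r) := by
  have hx : ∀ i : Fin (d + 1), i ≠ 0 → (Fin.cons w fun _ => z : Fin (d + 1) → R) i = z := by
    intro i hi
    obtain ⟨j, rfl⟩ := Fin.exists_succ_eq_of_ne_zero hi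
    rfl
  change ∏ r ∈ cycleReps σ, T ((List.range (Function.minimalPeriod σ r)).map
    (fun j => (Fin.cons w fun _ => z : Fin (d + 1) → R) ((σ ^ j) r))).prod = _
  rw [← Finset.mul_prod_erase _ _ (zero_mem_cycleReps σ)]
  congr 1
  · obtain ⟨l, hl⟩ := Nat.exists_eq_succ_of_ne_zero (minimalPeriod_perm_pos σ 0).ne'
    rw [hl, List.range_succ_eq_map, List.map_cons, List.prod_cons, List.map_map]
    congr 2
    rw [List.prod_eq_pow_card (m := z)]
    · simp
    · intro y hy
      obtain ⟨j, hj, rfl⟩ := List.mem_map.1 hy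
      refine hx _ fun h => ?_
      rw [← Equiv.Perm.iterate_eq_pow] at h
      exact Function.not_isPeriodicPt_of_pos_of_lt_minimalPeriod (Nat.succ_ne_zero j)
        (by rw [hl]; exact Nat.succ_lt_succ (List.mem_range.1 hj)) h
  · refine Finset.prod_congr rfl fun r hr => ?_
    rw [Finset.mem_erase] at hr
    rw [List.prod_eq_pow_card (m := z)]
    · simp
    · intro y hy
      obtain ⟨j, hj, rfl⟩ := List.mem_map.1 hy
      refine hx _ fun h => hr.1 ?_
      have h0 : σ.SameCycle r 0 := ⟨j, by simpa using h⟩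
      exact le_antisymm (mem_cycleReps.1 hr.2 0 h0) (Fin.zero_le r)

/-- If `T (z y)` lies in the ideal `I` for all `y`, then `T` of the multiples of high powers of `z`
lies in high powers of `I`: in the pseudo-character identity at `(w, z, …, z)` the long cycles
contribute `± d! T (w z ^ d)`, and all other permutations contribute a further factor in `I`. -/
theorem IsPseudorep.apply_pow_mul_mem {T : R →ₗ[A] B} {d : ℕ} (hT : IsPseudorep T d) (hd : 0 < d)
    {I : Ideal B} {z : R} (hz : ∀ y, T (z * y) ∈ I) (k : ℕ) (y : R) :
    T (z ^ (d * k) * y) ∈ I ^ k := by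
  classical
  induction k generalizing y with
  | zero => simp
  | succ k ih =>
    set w : R := y * z ^ (d * k) with hw
    have hwz : ∀ j, T (w * z ^ j) ∈ I ^ k := fun j => by
      rw [hw, mul_assoc, hT.central, mul_assoc]
      exact ih _
    have hF := hT.frobenius (Fin.cons w fun _ => z)
    rw [← Finset.sum_filter_add_sum_filter_not Finset.univ
      (fun σ : Equiv.Perm (Fin (d + 1)) => σ.cycleType = {d + 1})] at hF
    have h1 : ∑ σ : Equiv.Perm (Fin (d + 1)) with σ.cycleType = {d + 1},
        ((Equiv.Perm.sign σ : ℤ) : B) * cycleProd T σ (Fin.cons w fun _ => z) =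
        (-1) ^ d * ((d.factorial : ℕ) : B) * T (w * z ^ d) := by
      have hc : (Finset.univ.filter fun σ : Equiv.Perm (Fin (d + 1)) =>
          σ.cycleType = {d + 1}).card = d.factorial := by
        rw [Equiv.Perm.card_of_cycleType_singleton (by omega) (by simp)]
        simp
      rw [Finset.sum_congr rfl (g := fun _ => (-1) ^ d * T (w * z ^ d)), Finset.sum_const, hc,
        nsmul_eq_mul]
      · ring
      · intro σ hσ
        rw [Finset.mem_filter] at hσ
        have hr := (cycleReps_eq_singleton_iff hd σ).2 hσ.2
        have hp : Function.minimalPeriod σ 0 = d + 1 := by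
          have := Fintype.card_congr (cycleEquiv σ)
          rw [Fintype.card_sigma] at this
          simp only [Fintype.card_fin] at this
          rw [Finset.sum_coe_sort (cycleReps σ) (fun r => Function.minimalPeriod σ r), hr,
            Finset.sum_singleton] at this
          exact this
        rw [cycleProd_cons_const, hr, hp, Equiv.Perm.sign_of_cycleType, hσ.2]
        simp [pow_succ]
    have h2 : ∑ σ : Equiv.Perm (Fin (d + 1)) with ¬ σ.cycleType = {d + 1},
        ((Equiv.Perm.sign σ : ℤ) : B) * cycleProd T σ (Fin.cons w fun _ => z) ∈ I ^ (k + 1) := by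
      refine Ideal.sum_mem _ fun σ hσ => Ideal.mul_mem_left _ _ ?_
      rw [Finset.mem_filter, ← cycleReps_eq_singleton_iff hd] at hσ
      rw [cycleProd_cons_const, pow_succ]
      refine Ideal.mul_mem_mul (hwz _) ?_
      have hne : ((cycleReps σ).erase 0).Nonempty := by
        rw [Finset.nonempty_iff_ne_empty]
        intro h
        refine hσ.2 (Finset.eq_singleton_iff_unique_mem.2 ⟨zero_mem_cycleReps σ, fun i hi => ?_⟩)
        by_contra hi0
        have : i ∈ (cycleReps σ).erase 0 := Finset.mem_erase.2 ⟨hi0, hi⟩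
        simp [h] at this
      obtain ⟨r, hr⟩ := hne
      rw [← Finset.mul_prod_erase _ _ hr]
      refine Ideal.mul_mem_right _ _ ?_
      obtain ⟨l, hl⟩ := Nat.exists_eq_succ_of_ne_zero (minimalPeriod_perm_pos σ r).ne'
      rw [hl, pow_succ']
      exact hz _
    rw [h1] at hF
    have h3 : (-1) ^ d * ((d.factorial : ℕ) : B) * T (w * z ^ d) ∈ I ^ (k + 1) := by
      rw [eq_neg_of_add_eq_zero_left hF]
      exact neg_mem h2
    have hu : IsUnit ((-1) ^ d * ((d.factorial : ℕ) : B)) :=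
      ((isUnit_neg_one).pow d).mul hT.factorial_isUnit
    have h4 := (Ideal.unit_mul_mem_iff_mem _ hu).1 h3
    rwa [hw, mul_assoc, ← pow_add, hT.central, ← mul_add_one] at h4

/-- Let `T` be the sum of pseudo-representations `T₁` and `T₂` and let `x` be close to an
idempotent with `T₁` supported on it and `T₂` on its complement. Then `T` is small on the products
through both powers of `x` and of `1 - x`. -/
theorem apply_mul_mem_of_add {T : R →ₗ[A] A} {J : Ideal A} {T₁ T₂ : R →ₗ[A] A ⧸ J} {d₁ d₂ : ℕ}
    (h₁ : IsPseudorep T₁ d₁) (h₂ : IsPseudorep T₂ d₂) (hd₁ : 0 < d₁) (hd₂ : 0 < d₂)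
    (hT : ∀ x, Ideal.Quotient.mk J (T x) = T₁ x + T₂ x) {I : Ideal (A ⧸ J)} {x : R}
    (hx₁ : ∀ y, T₁ ((1 - x) * y) ∈ I) (hx₂ : ∀ y, T₂ (x * y) ∈ I) (N : ℕ) (a b : R) :
    Ideal.Quotient.mk J (T (x ^ (d₂ * N) * a * ((1 - x) ^ (d₁ * N) * b))) ∈ I ^ N := by
  rw [hT]
  refine add_mem ?_ ?_
  · rw [h₁.central, mul_assoc]
    exact h₁.apply_pow_mul_mem hd₁ hx₁ N _
  · rw [mul_assoc]
    exact h₂.apply_pow_mul_mem hd₂ hx₂ N _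

end Nilpotency

/-! ### Density for two absolutely irreducible representations -/

section Density

open Module in
/-- The density theorem for two simple modules without non-zero maps between them. -/
theorem exists_smul_eq_of_isSimpleModule {R V W : Type*} [Ring R] [AddCommGroup V] [Module R V]
    [AddCommGroup W] [Module R W] [IsSimpleModule R V] [IsSimpleModule R W]
    (hVW : ∀ φ : V →ₗ[R] W, φ = 0) (hWV : ∀ φ : W →ₗ[R] V, φ = 0) (f : V →+ V) (g : W →+ W)
    (hf : ∀ (φ : V →ₗ[R] V) (v : V), f (φ v) = φ (f v))
    (hg : ∀ (φ : W →ₗ[R] W) (w : W), g (φ w) = φ (g w)) (s : Finset V) (t : Finset W) :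
    ∃ r : R, (∀ v ∈ s, f v = r • v) ∧ ∀ w ∈ t, g w = r • w := by
  classical
  have hss : IsSemisimpleModule R (V × W) := by
    have h1 : IsSemisimpleModule R (LinearMap.range (LinearMap.inl R V W)) := .range _
    have h2 : IsSemisimpleModule R (LinearMap.range (LinearMap.inr R V W)) := .range _
    have h3 := h1.sup h2
    rw [LinearMap.sup_range_inl_inr] at h3
    exact .congr Submodule.topEquiv.symm
  -- the endomorphisms of `V × W` are block diagonal, so `f × g` commutes with them
  let F : End (End R (V × W)) (V × W) :=
    { toFun := fun p => (f p.1, g p.2)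
      map_add' := fun p q => by simp
      map_smul' := fun φ p => by
        have h12 := LinearMap.congr_fun (hVW ((LinearMap.snd R V W).comp
          (φ.comp (LinearMap.inl R V W))))
        have h21 := LinearMap.congr_fun (hWV ((LinearMap.fst R V W).comp
          (φ.comp (LinearMap.inr R V W))))
        have h1 := hf ((LinearMap.fst R V W).comp (φ.comp (LinearMap.inl R V W))) p.1
        have h2 := hg ((LinearMap.snd R V W).comp (φ.comp (LinearMap.inr R V W))) p.2
        simp only [LinearMap.comp_apply, LinearMap.inl_apply, LinearMap.inr_apply,
          LinearMap.fst_apply, LinearMap.snd_apply, LinearMap.zero_apply] at h12 h21 h1 h2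
        have hφ : ∀ v w, φ (v, w) = ((φ (v, 0)).1, (φ (0, w)).2) := fun v w => by
          have : (v, w) = (v, 0) + ((0, w) : V × W) := by simp
          rw [this, map_add]
          ext
          · simp [h21]
          · simp [h12]
        obtain ⟨v, w⟩ := p
        simp only [RingHom.id_apply, End.smul_def]
        rw [hφ v w, hφ (f v) (g w)]
        exact Prod.ext h1 h2 }
  obtain ⟨r, hr⟩ := jacobson_density F
    (s.image (fun v => ((v, 0) : V × W)) ∪ t.image (fun w => ((0, w) : V × W)))
  refine ⟨r, fun v hv => ?_, fun w hw => ?_⟩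
  · exact congrArg Prod.fst (hr (v, 0)
      (Finset.mem_union_left _ (Finset.mem_image_of_mem _ hv)))
  · exact congrArg Prod.snd (hr (0, w)
      (Finset.mem_union_right _ (Finset.mem_image_of_mem _ hw)))

theorem vecRep_apply {G k : Type*} [Group G] [CommRing k] {n : ℕ} (τ : G →* GL (Fin n) k) (g : G)
    (v : Fin n → k) : vecRep τ g v = (τ g : Matrix (Fin n) (Fin n) k).mulVec v := rfl

variable {G : Type u} [Group G] {k : Type u} [Field k]

theorem IsAbsIrreducible.pos {n : ℕ} {τ : G →* GL (Fin n) k} (h : IsAbsIrreducible τ) :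
    0 < n := by
  rcases Nat.eq_zero_or_pos n with rfl | hn
  · exfalso
    obtain ⟨x, y, hxy⟩ := (show IsSimpleOrder _ from h).toNontrivial
    exact hxy (Subrepresentation.toSubmodule_injective (Subsingleton.elim _ _))
  · exact hn

theorem map_mulVec_comp {K : Type*} [Field K] (i : k →+* K) {n : ℕ}
    (M : Matrix (Fin n) (Fin n) k) (v : Fin n → k) :
    (M.map i).mulVec (i ∘ v) = i ∘ M.mulVec v := by
  funext j
  simp [Matrix.mulVec, dotProduct]

/-- An absolutely irreducible representation is irreducible: a stable subspace remains stable,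
non-zero and proper after extension of scalars. -/
theorem IsAbsIrreducible.isIrreducible {n : ℕ} {τ : G →* GL (Fin n) k} (h : IsAbsIrreducible τ) :
    (vecRep τ).IsIrreducible := by
  have hn := h.pos
  set K := AlgebraicClosure k
  set i := algebraMap k K
  have hs : IsSimpleOrder (Subrepresentation
    (vecRep ((Matrix.GeneralLinearGroup.map (algebraMap k K)).comp τ))) := h
  have : NeZero n := ⟨hn.ne'⟩
  refine { exists_pair_ne := ⟨⊥, ⊤, fun hbt => ?_⟩, eq_bot_or_eq_top := fun U => ?_ }
  · exact bot_ne_top (congrArg Subrepresentation.toSubmodule hbt :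
      (⊥ : Submodule k (Fin n → k)) = ⊤)
  let U' : Subrepresentation (vecRep ((Matrix.GeneralLinearGroup.map (algebraMap k K)).comp τ)) :=
    { toSubmodule := Submodule.span K ((fun v : Fin n → k => i ∘ v) '' (U.toSubmodule : Set _))
      apply_mem_toSubmodule := fun g v hv => by
        induction hv using Submodule.span_induction with
        | mem v hv =>
          obtain ⟨u, hu, rfl⟩ := hv
          refine Submodule.subset_span ⟨_, U.apply_mem_toSubmodule g hu, ?_⟩
          exact (map_mulVec_comp i _ _).symm
        | zero => rw [map_zero]; exact zero_mem _
        | add v w _ _ hv hw => rw [map_add]; exact add_mem hv hw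
        | smul c v _ hv => rw [map_smul]; exact Submodule.smul_mem _ _ hv }
  rcases hs.eq_bot_or_eq_top U' with hU | hU
  · left
    refine Subrepresentation.toSubmodule_injective ((Submodule.eq_bot_iff _).2 fun u hu => ?_)
    have h1 : i ∘ u ∈ U'.toSubmodule := Submodule.subset_span ⟨u, hu, rfl⟩
    rw [hU] at h1
    have h2 : i ∘ u = 0 := h1
    funext j
    exact i.injective (by simpa using congrFun h2 j)
  · right
    by_contra hne
    have hlt : U.toSubmodule < ⊤ := lt_top_iff_ne_top.2 fun h =>
      hne (Subrepresentation.toSubmodule_injective h)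
    -- a linear form that vanishes on `U` extends to one that vanishes on `U'`
    obtain ⟨l, hl0, hl⟩ := Submodule.exists_le_ker_of_lt_top _ hlt
    let l' : (Fin n → K) →ₗ[K] K := ∑ j, i (l (Pi.single j 1)) • LinearMap.proj j
    have hl' : ∀ v, l' v = ∑ j, i (l (Pi.single j 1)) * v j := fun v => by simp [l']
    have hle : U'.toSubmodule ≤ LinearMap.ker l' := by
      refine Submodule.span_le.2 ?_
      rintro _ ⟨u, hu, rfl⟩
      have h0 : l u = 0 := hl hu
      rw [LinearMap.pi_apply_eq_sum_univ l u] at h0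
      have := congrArg i h0
      simp only [map_sum, smul_eq_mul, map_mul, map_zero] at this
      change l' (i ∘ u) = 0
      rw [hl', ← this]
      refine Finset.sum_congr rfl fun j _ => ?_
      rw [mul_comm, Function.comp_apply]
      congr 4
      funext a
      simp [Pi.single_apply, eq_comm]
    refine hl0 (LinearMap.pi_ext' fun j => LinearMap.ext_ring ?_)
    have h1 : (Pi.single j 1 : Fin n → K) ∈ U'.toSubmodule := by rw [hU]; trivial
    have h2 : l' (Pi.single j 1) = 0 := hle h1
    rw [hl'] at h2
    simp only [Pi.single_apply, mul_ite, mul_one, mul_zero, Finset.sum_ite_eq',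
      Finset.mem_univ, if_true] at h2
    exact i.injective (by simpa using h2)

/-- Schur's lemma: the endomorphisms of an absolutely irreducible representation are scalars. -/
theorem IsAbsIrreducible.exists_eq_smul {n : ℕ} {τ : G →* GL (Fin n) k} (h : IsAbsIrreducible τ)
    (φ : (vecRep τ).IntertwiningMap (vecRep τ)) : ∃ c : k, ∀ v, φ v = c • v := by
  have hn := h.pos
  set K := AlgebraicClosure k
  set i := algebraMap k K
  have hs : (vecRep ((Matrix.GeneralLinearGroup.map (algebraMap k K)).comp τ)).IsIrreducible := h
  set M := LinearMap.toMatrix' φ.toLinearMap with hM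
  have hφ : ∀ v, φ v = M.mulVec v := fun v =>
    (LinearMap.congr_fun (Matrix.toLin'_toMatrix' φ.toLinearMap) v).symm
  have hcomm : ∀ g, M * (τ g : Matrix (Fin n) (Fin n) k) = (τ g : Matrix _ _ k) * M := fun g => by
    refine Matrix.toLin'.injective (LinearMap.ext fun v => ?_)
    have : φ (vecRep τ g v) = vecRep τ g (φ v) := LinearMap.congr_fun (φ.isIntertwining' g) v
    rw [vecRep_apply, vecRep_apply, hφ, hφ] at this
    simpa using this
  let Φ : (vecRep ((Matrix.GeneralLinearGroup.map (algebraMap k K)).comp τ)).IntertwiningMap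
      (vecRep ((Matrix.GeneralLinearGroup.map (algebraMap k K)).comp τ)) :=
    { toLinearMap := Matrix.toLin' (M.map i)
      isIntertwining' := fun g => by
        refine LinearMap.ext fun v => ?_
        change (M.map i).mulVec (((τ g : Matrix (Fin n) (Fin n) k).map i).mulVec v) =
          ((τ g : Matrix (Fin n) (Fin n) k).map i).mulVec ((M.map i).mulVec v)
        rw [Matrix.mulVec_mulVec, Matrix.mulVec_mulVec, ← Matrix.map_mul, ← Matrix.map_mul,
          hcomm] }
  -- after extension of scalars `φ` is a scalar, and any diagonal entry of its matrix is this scalar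
  obtain ⟨c, hc⟩ := Representation.IsIrreducible.algebraMap_intertwiningMap_bijective_of_isAlgClosed
    (ρ := vecRep ((Matrix.GeneralLinearGroup.map (algebraMap k K)).comp τ)).2 Φ
  have hMi : M.map i = c • (1 : Matrix (Fin n) (Fin n) K) := by
    refine Matrix.toLin'.injective (LinearMap.ext fun v => ?_)
    have h1 : Φ v = c • v := by rw [← hc]; rfl
    rw [map_smul, Matrix.toLin'_one]
    exact h1
  refine ⟨M ⟨0, hn⟩ ⟨0, hn⟩, fun v => ?_⟩
  have hc0 : i (M ⟨0, hn⟩ ⟨0, hn⟩) = c := by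
    simpa using congrFun (congrFun hMi ⟨0, hn⟩) ⟨0, hn⟩
  have hM1 : M = M ⟨0, hn⟩ ⟨0, hn⟩ • 1 := by
    ext a b
    refine i.injective ?_
    have := congrFun (congrFun hMi a) b
    rw [Matrix.map_apply] at this
    rw [this, ← hc0]
    simp [Matrix.one_apply, apply_ite i]
  rw [hφ]
  conv_lhs => rw [hM1, Matrix.smul_mulVec, Matrix.one_mulVec]

/-- The images of the group elements under two non-isomorphic absolutely irreducible
representations span the product of the two matrix algebras. -/
theorem span_range_prod_eq_top {n₁ n₂ : ℕ} {τ₁ : G →* GL (Fin n₁) k} {τ₂ : G →* GL (Fin n₂) k}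
    (h₁ : IsAbsIrreducible τ₁) (h₂ : IsAbsIrreducible τ₂)
    (hτ : IsEmpty ((vecRep τ₁).Equiv (vecRep τ₂))) :
    Submodule.span k (Set.range fun g =>
      ((τ₁ g : Matrix (Fin n₁) (Fin n₁) k), (τ₂ g : Matrix (Fin n₂) (Fin n₂) k))) = ⊤ := by
  classical
  have := h₁.isIrreducible
  have := h₂.isIrreducible
  have hτ' : IsEmpty ((vecRep τ₂).Equiv (vecRep τ₁)) := ⟨fun e => hτ.false e.symm⟩
  rw [eq_top_iff]
  rintro ⟨M₁, M₂⟩ -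
  obtain ⟨r, hr₁, hr₂⟩ := exists_smul_eq_of_isSimpleModule (R := k[G])
    (V := (vecRep τ₁).asModule) (W := (vecRep τ₂).asModule)
    (fun φ => (Representation.IntertwiningMap.equivLinearMapAsModule _ _).symm.injective
      (Subsingleton.elim _ _))
    (fun φ => (Representation.IntertwiningMap.equivLinearMapAsModule _ _).symm.injective
      (Subsingleton.elim _ _))
    (Matrix.toLin' M₁).toAddMonoidHom (Matrix.toLin' M₂).toAddMonoidHom
    (fun φ v => by
      obtain ⟨c, hc⟩ := h₁.exists_eq_smul
        ((Representation.IntertwiningMap.equivLinearMapAsModule _ _).symm φ)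
      have hc' : ∀ v, φ v = c • v := hc
      rw [hc', hc']
      exact map_smul (Matrix.toLin' M₁) c v)
    (fun φ v => by
      obtain ⟨c, hc⟩ := h₂.exists_eq_smul
        ((Representation.IntertwiningMap.equivLinearMapAsModule _ _).symm φ)
      have hc' : ∀ v, φ v = c • v := hc
      rw [hc', hc']
      exact map_smul (Matrix.toLin' M₂) c v)
    (Finset.univ.image fun j => (Pi.single j 1 : Fin n₁ → k))
    (Finset.univ.image fun j => (Pi.single j 1 : Fin n₂ → k))
  have key : ∀ r : k[G], ∃ p ∈ Submodule.span k (Set.range fun g =>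
      ((τ₁ g : Matrix (Fin n₁) (Fin n₁) k), (τ₂ g : Matrix (Fin n₂) (Fin n₂) k))),
      (∀ v : (vecRep τ₁).asModule, r • v =
        (vecRep τ₁).asModuleEquiv.symm (p.1.mulVec ((vecRep τ₁).asModuleEquiv v))) ∧
      (∀ v : (vecRep τ₂).asModule, r • v =
        (vecRep τ₂).asModuleEquiv.symm (p.2.mulVec ((vecRep τ₂).asModuleEquiv v))) := by
    intro r
    induction r using MonoidAlgebra.induction_linear with
    | zero =>
      refine ⟨0, zero_mem _, fun v => ?_, fun v => ?_⟩
      · rw [zero_smul]; exact (Matrix.zero_mulVec v).symm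
      · rw [zero_smul]; exact (Matrix.zero_mulVec v).symm
    | add x y hx hy =>
      obtain ⟨p, hp, hp1, hp2⟩ := hx
      obtain ⟨q, hq, hq1, hq2⟩ := hy
      refine ⟨p + q, add_mem hp hq, fun v => ?_, fun v => ?_⟩
      · rw [add_smul, hp1, hq1]; exact (Matrix.add_mulVec p.1 q.1 (v : Fin n₁ → k)).symm
      · rw [add_smul, hp2, hq2]; exact (Matrix.add_mulVec p.2 q.2 (v : Fin n₂ → k)).symm
    | single g a =>
      refine ⟨a • (_, _), Submodule.smul_mem _ _ (Submodule.subset_span ⟨g, rfl⟩),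
        fun v => ?_, fun v => ?_⟩
      · rw [Representation.single_smul]; exact (Matrix.smul_mulVec a _ v).symm
      · rw [Representation.single_smul]; exact (Matrix.smul_mulVec a _ v).symm
  obtain ⟨p, hp, hp1, hp2⟩ := key r
  have e1 : M₁ = p.1 := Matrix.ext_of_mulVec_single fun j => by
    have := hr₁ (Pi.single j 1) (Finset.mem_image_of_mem _ (Finset.mem_univ j))
    exact this.trans (hp1 _)
  have e2 : M₂ = p.2 := Matrix.ext_of_mulVec_single fun j => by
    have := hr₂ (Pi.single j 1) (Finset.mem_image_of_mem _ (Finset.mem_univ j))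
    exact this.trans (hp2 _)
  rw [e1, e2]
  exact hp

end Density

/-! ### Extension classes and splittings -/

section Splitting

open CategoryTheory CategoryTheory.Abelian

variable {G : Type u} [Group G] {k : Type u} [Field k]
variable {V₁ V V₂ V' : Type u} [AddCommGroup V₁] [Module k V₁] [AddCommGroup V] [Module k V]
  [AddCommGroup V₂] [Module k V₂] [AddCommGroup V'] [Module k V']
  {σ₁ : Representation k G V₁} {σ : Representation k G V}
  {σ₂ : Representation k G V₂} {σ' : Representation k G V'}

theorem IsShortExact.extClass_eq_zero {i : σ₁.IntertwiningMap σ} {q : σ.IntertwiningMap σ₂}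
    (h : IsShortExact i q) (r : σ.IntertwiningMap σ₁) (hr : ∀ v, r (i v) = v) :
    h.extClass = 0 := by
  have h1 : toModHom i ≫ toModHom r = 𝟙 (toMod σ₁) := by
    ext x
    exact hr x
  have h2 : h.extClass.comp (Ext.mk₀ (toModHom i)) (add_zero 1) = 0 :=
    h.shortExact.extClass_comp
  calc h.extClass = h.extClass.comp (Ext.mk₀ (𝟙 (toMod σ₁))) (add_zero 1) :=
        (Ext.comp_mk₀_id _).symm
    _ = (h.extClass.comp (Ext.mk₀ (toModHom i)) (add_zero 1)).comp (Ext.mk₀ (toModHom r))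
          (add_zero 1) := by
        rw [← h1, ← Ext.mk₀_comp_mk₀, Ext.comp_assoc_of_second_deg_zero]
    _ = 0 := by rw [h2, Ext.zero_comp]

/-- A map on the kernel of an extension that kills the class of the extension extends. -/
theorem IsShortExact.exists_extension {i : σ₁.IntertwiningMap σ} {q : σ.IntertwiningMap σ₂}
    (h : IsShortExact i q) (f : σ₁.IntertwiningMap σ')
    (hf : h.extClass.comp (Ext.mk₀ (toModHom f)) (add_zero 1) = 0) :
    ∃ r : σ.IntertwiningMap σ', ∀ v, r (i v) = f v := by
  obtain ⟨x, hx⟩ := Ext.contravariant_sequence_exact₁ h.shortExact (toMod σ')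
    (Ext.mk₀ (toModHom f)) (add_zero 1) hf
  obtain ⟨y, rfl⟩ := (Ext.mk₀_bijective _ _).2 x
  rw [Ext.mk₀_comp_mk₀] at hx
  have hy := (Ext.mk₀_bijective _ _).1 hx
  refine ⟨(Representation.IntertwiningMap.equivLinearMapAsModule σ σ').symm y.hom, fun v => ?_⟩
  exact congrArg (fun t : toMod σ₁ ⟶ toMod σ' => t.hom v) hy

end Splitting

/-! ### Diagonalization of a matrix with distinct residual eigenvalues -/

section Diagonalization

open Polynomial IsLocalRing

theorem exists_aeval_fromBlocks {k m n : Type*} [CommRing k] [Fintype m] [DecidableEq m]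
    [Fintype n] [DecidableEq n] (M : Matrix m m k) (b : Matrix m n k) (N : Matrix n n k)
    (q : k[X]) : ∃ b' : Matrix m n k, aeval (Matrix.fromBlocks M b 0 N) q =
      Matrix.fromBlocks (aeval M q) b' 0 (aeval N q) := by
  induction q using Polynomial.induction_on' with
  | add p q hp hq =>
    obtain ⟨b₁, h₁⟩ := hp
    obtain ⟨b₂, h₂⟩ := hq
    exact ⟨b₁ + b₂, by simp [h₁, h₂, Matrix.fromBlocks_add]⟩
  | monomial l a =>
    have hpow : ∃ b' : Matrix m n k, Matrix.fromBlocks M b 0 N ^ l =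
        Matrix.fromBlocks (M ^ l) b' 0 (N ^ l) := by
      induction l with
      | zero => exact ⟨0, by simp⟩
      | succ l ih =>
        obtain ⟨b', hb'⟩ := ih
        exact ⟨M ^ l * b + b' * N, by simp [pow_succ, hb', Matrix.fromBlocks_multiply]⟩
    obtain ⟨b', hb'⟩ := hpow
    refine ⟨a • b', ?_⟩
    simp [aeval_monomial, hb', ← Algebra.smul_def, Matrix.fromBlocks_smul]

theorem aeval_diagonal {k m : Type*} [CommRing k] [Fintype m] [DecidableEq m] (d : m → k)
    (q : k[X]) : aeval (Matrix.diagonal d) q = Matrix.diagonal fun i => q.eval (d i) := by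
  induction q using Polynomial.induction_on' with
  | add p q hp hq => rw [map_add, hp, hq, Matrix.diagonal_add]; simp
  | monomial l a =>
    rw [aeval_monomial, Matrix.diagonal_pow, ← Algebra.smul_def, ← Matrix.diagonal_smul]
    congr 1
    funext i
    simp

/-- The polynomial with value `1` at `a i` and `0` at the other `a j`, provided that the
differences `a i - a j` are units. -/
def interpolation {ι A : Type*} [Fintype ι] [DecidableEq ι] [CommRing A] (a : ι → A) (i : ι) :
    A[X] :=
  ∏ j ∈ Finset.univ.erase i, C (Ring.inverse (a i - a j)) * (X - C (a j))

theorem eval_interpolation {ι A : Type*} [Fintype ι] [DecidableEq ι] [CommRing A] {a : ι → A}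
    (ha : ∀ i j, i ≠ j → IsUnit (a i - a j)) (i j : ι) :
    (interpolation a i).eval (a j) = if i = j then 1 else 0 := by
  rw [interpolation, eval_prod]
  split_ifs with h
  · subst h
    refine Finset.prod_eq_one fun j hj => ?_
    rw [Finset.mem_erase] at hj
    simp [Ring.inverse_mul_cancel _ (ha i j hj.1.symm)]
  · exact Finset.prod_eq_zero (Finset.mem_erase.2 ⟨Ne.symm h, Finset.mem_univ j⟩) (by simp)

variable {ι A : Type*} [Fintype ι] [DecidableEq ι] [CommRing A] [IsLocalRing A]
  [IsAdicComplete (maximalIdeal A) A]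

/-- Over a complete local ring, a monic polynomial whose reduction is a product of distinct linear
factors is a product of linear factors, by Hensel's lemma for each root. -/
theorem exists_eq_prod_X_sub_C {f : A[X]} (hf : f.Monic) {c : ι → A}
    (hc : ∀ i j, i ≠ j → IsUnit (c i - c j))
    (hfc : f.map (residue A) = ∏ i, (X - C (residue A (c i)))) :
    ∃ a : ι → A, (∀ i, residue A (a i) = residue A (c i)) ∧
      (∀ i j, i ≠ j → IsUnit (a i - a j)) ∧ f = ∏ i, (X - C (a i)) := by
  have hroot : ∀ i, ∃ a : A, f.IsRoot a ∧ a - c i ∈ maximalIdeal A := fun i => by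
    refine HenselianRing.is_henselian (I := maximalIdeal A) f hf (c i) ?_ ?_
    · rw [← residue_eq_zero_iff, ← eval_map_apply, hfc, eval_prod]
      exact Finset.prod_eq_zero (Finset.mem_univ i) (by simp)
    · have hu : IsUnit (residue A (f.derivative.eval (c i))) := by
        rw [← eval_map_apply, ← derivative_map, hfc, derivative_prod_finset, eval_finsetSum,
          Finset.sum_eq_single i]
        · rw [eval_mul, eval_prod, isUnit_iff_ne_zero]
          simp only [eval_sub, eval_X, eval_C, derivative_X_sub_C, eval_one, mul_one]
          refine Finset.prod_ne_zero_iff.2 fun j hj => ?_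
          rw [← map_sub]
          exact ((hc i j (Finset.ne_of_mem_erase hj).symm).map (residue A)).ne_zero
        · intro j _ hj
          rw [eval_mul, eval_prod, Finset.prod_eq_zero
            (Finset.mem_erase.2 ⟨hj.symm, Finset.mem_univ i⟩) (by simp), zero_mul]
        · simp
      exact hu
  choose a ha hac using hroot
  have har : ∀ i, residue A (a i) = residue A (c i) := fun i => by
    rw [← sub_eq_zero, ← map_sub, residue_eq_zero_iff]
    exact hac i
  have hau : ∀ i j, i ≠ j → IsUnit (a i - a j) := fun i j hij => by
    have h1 := ((hc i j hij).map (residue A))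
    rw [map_sub, ← har, ← har, ← map_sub] at h1
    exact (isUnit_map_iff (residue A) _).1 h1
  refine ⟨a, har, hau, ?_⟩
  have hmon : (∏ i, (X - C (a i))).Monic := monic_prod_of_monic _ _ fun i _ => monic_X_sub_C _
  have hdvd : (∏ i, (X - C (a i))) ∣ f :=
    Finset.prod_dvd_of_coprime
      (fun i _ j _ hij => isCoprime_X_sub_C_of_isUnit_sub (hau i j hij))
      (fun i _ => dvd_iff_isRoot.2 (ha i))
  have hdeg : f.natDegree = (∏ i, (X - C (a i))).natDegree := by
    rw [← hf.natDegree_map (residue A), hfc, natDegree_prod_of_monic _ _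
      (fun i _ => monic_X_sub_C _), natDegree_prod_of_monic _ _ (fun i _ => monic_X_sub_C _)]
    simp
  exact (eq_of_monic_of_dvd_of_natDegree_le hmon hf hdvd hdeg.le)

/-- A matrix whose reduction is block upper triangular with diagonal blocks, all diagonal entries
being distinct, can be diagonalized by a matrix with block unipotent reduction. -/
theorem exists_diagonalization {n₁ n₂ : ℕ} (M : Matrix (Fin n₁ ⊕ Fin n₂) (Fin n₁ ⊕ Fin n₂) A)
    {c : Fin n₁ ⊕ Fin n₂ → A} (hc : ∀ i j, i ≠ j → IsUnit (c i - c j))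
    {b : Matrix (Fin n₁) (Fin n₂) (ResidueField A)}
    (hM : M.map (residue A) = Matrix.fromBlocks
      (Matrix.diagonal fun i => residue A (c (Sum.inl i))) b 0
      (Matrix.diagonal fun i => residue A (c (Sum.inr i)))) :
    ∃ (P Q : Matrix (Fin n₁ ⊕ Fin n₂) (Fin n₁ ⊕ Fin n₂) A) (a : Fin n₁ ⊕ Fin n₂ → A)
      (β : Matrix (Fin n₁) (Fin n₂) (ResidueField A)), P * Q = 1 ∧ Q * P = 1 ∧
      (∀ i j, i ≠ j → IsUnit (a i - a j)) ∧ M * P = P * Matrix.diagonal a ∧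
      P.map (residue A) = Matrix.fromBlocks 1 β 0 1 := by
  obtain ⟨a, har, hau, hprod⟩ := exists_eq_prod_X_sub_C M.charpoly_monic hc (by
    rw [← Matrix.charpoly_map, hM, Matrix.charpoly_fromBlocks_zero₂₁, Matrix.charpoly_diagonal,
      Matrix.charpoly_diagonal, Fintype.prod_sum_type])
  -- the `i`-th column of `P` is that of the projector to the eigenspace of `a i`
  set P : Matrix (Fin n₁ ⊕ Fin n₂) (Fin n₁ ⊕ Fin n₂) A :=
    Matrix.of fun l i => aeval M (interpolation a i) l i with hP
  have hMP : M * P = P * Matrix.diagonal a := by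
    ext l i
    have h0 : (M - algebraMap A _ (a i)) * aeval M (interpolation a i) = 0 := by
      have h1 : (X - C (a i)) * interpolation a i =
          C (∏ j ∈ Finset.univ.erase i, Ring.inverse (a i - a j)) * M.charpoly := by
        rw [hprod, interpolation, Finset.prod_mul_distrib, ← Finset.mul_prod_erase _ _
          (Finset.mem_univ i), map_prod]
        ring
      have h2 := congrArg (aeval M) h1
      rwa [map_mul, map_mul, Matrix.aeval_self_charpoly, mul_zero, map_sub, aeval_X,
        aeval_C] at h2
    rw [sub_mul, sub_eq_zero, ← Algebra.smul_def] at h0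
    have h3 := congrFun (congrFun h0 l) i
    rw [Matrix.mul_diagonal, Matrix.mul_apply]
    rw [Matrix.mul_apply, Matrix.smul_apply, smul_eq_mul, mul_comm (a i)] at h3
    exact h3
  have hmap : ∀ i, (aeval M (interpolation a i)).map (residue A) =
      aeval (M.map (residue A)) (interpolation (fun i => residue A (a i)) i) := by
    intro i
    have h1 : (interpolation a i).map (residue A) =
        interpolation (fun i => residue A (a i)) i := by
      simp only [interpolation, Polynomial.map_prod, Polynomial.map_mul, map_C,
        Polynomial.map_sub, map_X]
      refine Finset.prod_congr rfl fun j hj => ?_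
      have hu := hau i j (Finset.ne_of_mem_erase hj).symm
      congr 2
      rw [← map_sub]
      have h2 := congrArg (residue A) (Ring.inverse_mul_cancel _ hu)
      rw [map_mul, map_one] at h2
      rw [Ring.inverse_eq_inv']
      exact eq_inv_of_mul_eq_one_left h2
    rw [← h1]
    have h4 := Polynomial.map_aeval_eq_aeval_map (S := Matrix (Fin n₁ ⊕ Fin n₂) (Fin n₁ ⊕ Fin n₂) A)
      (T := ResidueField A) (U := Matrix (Fin n₁ ⊕ Fin n₂) (Fin n₁ ⊕ Fin n₂) (ResidueField A))
      (φ := residue A) (ψ := (residue A).mapMatrix) ?_ (interpolation a i) M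
    · exact h4
    · ext r x y
      simp [Matrix.algebraMap_matrix_apply, apply_ite (residue A)]
  have hau' : ∀ i j, i ≠ j → IsUnit (residue A (a i) - residue A (a j)) := fun i j hij => by
    rw [← map_sub]
    exact (hau i j hij).map _
  have hblock : ∀ i, ∃ b', (aeval M (interpolation a i)).map (residue A) =
      Matrix.fromBlocks (Matrix.diagonal fun l => if i = Sum.inl l then 1 else 0) b' 0
        (Matrix.diagonal fun l => if i = Sum.inr l then 1 else 0) := by
    intro i
    obtain ⟨b', hb'⟩ := exists_aeval_fromBlocks
      (Matrix.diagonal fun i => residue A (c (Sum.inl i))) b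
      (Matrix.diagonal fun i => residue A (c (Sum.inr i)))
      (interpolation (fun i => residue A (a i)) i)
    refine ⟨b', ?_⟩
    rw [hmap, hM, hb', aeval_diagonal, aeval_diagonal]
    simp only [← har]
    congr 2
    · funext l
      exact eval_interpolation hau' i (Sum.inl l)
    · funext l
      exact eval_interpolation hau' i (Sum.inr l)
  choose b' hb' using hblock
  have hPmap : P.map (residue A) = Matrix.fromBlocks 1
      (Matrix.of fun l j => b' (Sum.inr j) l j) 0 1 := by
    ext l i
    have h1 := congrFun (congrFun (hb' i) l) i
    rw [Matrix.map_apply] at h1 ⊢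
    rw [hP, Matrix.of_apply, h1]
    rcases l with l | l <;> rcases i with i | i <;>
      simp [Matrix.diagonal_apply, Matrix.one_apply]
    all_goals grind
  have hdet : IsUnit P.det := by
    refine (isUnit_map_iff (residue A) _).1 ?_
    rw [RingHom.map_det, RingHom.mapMatrix_apply, hPmap, Matrix.det_fromBlocks_zero₂₁]
    simp
  exact ⟨P, P⁻¹, a, _, Matrix.mul_nonsing_inv P hdet, Matrix.nonsing_inv_mul P hdet, hau, hMP,
    hPmap⟩

end Diagonalization

/-! ### The image of a residually reducible representation -/

section Corner

variable {A R ι : Type*} [CommRing A] [Ring R] [Algebra A R] [Fintype ι] [DecidableEq ι]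
  {σ : R →ₐ[A] Matrix ι ι A}

theorem isUnit_sub_of_factorial {N i j : ℕ} (hN : IsUnit ((N.factorial : ℕ) : A)) (hi : i < N)
    (hij : j < i) : IsUnit ((i : A) - (j : A)) := by
  rw [← Nat.cast_sub hij.le]
  obtain ⟨c, hc⟩ : i - j ∣ N.factorial := Nat.dvd_factorial (by omega) (by omega)
  rw [hc, Nat.cast_mul] at hN
  exact isUnit_of_mul_isUnit_left hN

/-- The representation `Q ρ P`, where `Q = P⁻¹`. -/
def conjHom (ρ : R →ₐ[A] Matrix ι ι A) {P Q : Matrix ι ι A} (hPQ : P * Q = 1) (hQP : Q * P = 1) :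
    R →ₐ[A] Matrix ι ι A :=
  AlgHom.ofLinearMap
    ((LinearMap.mulRight A P).comp ((LinearMap.mulLeft A Q).comp ρ.toLinearMap))
    (by simp [hQP])
    (fun x y => by
      simp only [LinearMap.comp_apply, AlgHom.toLinearMap_apply, LinearMap.mulLeft_apply,
        LinearMap.mulRight_apply, map_mul]
      calc Q * (ρ x * ρ y) * P = Q * ρ x * 1 * ρ y * P := by simp [mul_assoc]
        _ = _ := by rw [← hPQ]; simp [mul_assoc])

theorem conjHom_apply (ρ : R →ₐ[A] Matrix ι ι A) {P Q : Matrix ι ι A} (hPQ : P * Q = 1)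
    (hQP : Q * P = 1) (x : R) :
    conjHom ρ hPQ hQP x = Q * ρ x * P := rfl

/-- For a matrix representation `σ`, the ideal of all `c` such that the elementary matrix with
entry `c` at `(i, j)` lies in the image of `σ`. -/
def cornerIdeal (σ : R →ₐ[A] Matrix ι ι A) (i j : ι) : Ideal A where
  carrier := {c | Matrix.single i j c ∈ σ.range}
  add_mem' {a b} ha hb := by
    rw [Set.mem_ofPred_eq, Matrix.single_add]
    exact add_mem ha hb
  zero_mem' := by
    rw [Set.mem_ofPred_eq, Matrix.single_zero]
    exact zero_mem _
  smul_mem' c a ha := by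
    rw [Set.mem_ofPred_eq, ← Matrix.smul_single]
    exact Subalgebra.smul_mem _ ha c

theorem mem_cornerIdeal {i j : ι} {c : A} :
    c ∈ cornerIdeal σ i j ↔ Matrix.single i j c ∈ σ.range := Iff.rfl

theorem mul_mem_cornerIdeal {i j l : ι} {c d : A} (hc : c ∈ cornerIdeal σ i j)
    (hd : d ∈ cornerIdeal σ j l) : c * d ∈ cornerIdeal σ i l := by
  rw [mem_cornerIdeal] at *
  have := mul_mem hc hd
  rwa [Matrix.single_mul_single_same] at this

theorem cornerIdeal_le_of_eq_top {i j i' j' : ι} (hi : cornerIdeal σ i' i = ⊤)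
    (hj : cornerIdeal σ j j' = ⊤) : cornerIdeal σ i j ≤ cornerIdeal σ i' j' := fun c hc => by
  have h1 : (1 : A) ∈ cornerIdeal σ i' i := hi ▸ Submodule.mem_top
  have h2 : (1 : A) ∈ cornerIdeal σ j j' := hj ▸ Submodule.mem_top
  simpa using mul_mem_cornerIdeal (mul_mem_cornerIdeal h1 hc) h2

/-- When the image contains the diagonal idempotents, it is cut out by conditions on the single
entries. -/
theorem mem_range_iff_of_diag (hσ : ∀ i, cornerIdeal σ i i = ⊤) (M : Matrix ι ι A) :
    M ∈ σ.range ↔ ∀ i j, M i j ∈ cornerIdeal σ i j := by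
  constructor
  · intro hM i j
    have h1 : ∀ i, Matrix.single i i (1 : A) ∈ σ.range := fun i =>
      mem_cornerIdeal.1 (hσ i ▸ Submodule.mem_top)
    have := mul_mem (mul_mem (h1 i) hM) (h1 j)
    rw [mem_cornerIdeal]
    rwa [Matrix.single_mul_mul_single, one_mul, mul_one] at this
  · intro hM
    rw [Matrix.matrix_eq_sum_single M]
    exact sum_mem fun i _ => sum_mem fun j _ => hM i j

end Corner

section Image

open IsLocalRing

variable {G : Type u} [Group G] {A : Type u} [CommRing A] [IsLocalRing A] {n₁ n₂ : ℕ}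
  {ρ : A[G] →ₐ[A] Matrix (Fin n₁ ⊕ Fin n₂) (Fin n₁ ⊕ Fin n₂) A}
  {τ₁ : G →* GL (Fin n₁) (ResidueField A)} {τ₂ : G →* GL (Fin n₂) (ResidueField A)}

/-- `A[G]` maps onto the product of the matrix algebras in which `τ₁` and `τ₂` take values. -/
theorem HasReduction.exists_map_eq_fromBlocks (h : HasReduction ρ τ₁ τ₂)
    (hτ₁ : IsAbsIrreducible τ₁) (hτ₂ : IsAbsIrreducible τ₂)
    (hτ : IsEmpty ((vecRep τ₁).Equiv (vecRep τ₂)))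
    (M₁ : Matrix (Fin n₁) (Fin n₁) (ResidueField A))
    (M₂ : Matrix (Fin n₂) (Fin n₂) (ResidueField A)) :
    ∃ x b, (ρ x).map (residue A) = Matrix.fromBlocks M₁ b 0 M₂ := by
  have hmem : (M₁, M₂) ∈ Submodule.span (ResidueField A) (Set.range fun g =>
      ((τ₁ g : Matrix (Fin n₁) (Fin n₁) (ResidueField A)),
        (τ₂ g : Matrix (Fin n₂) (Fin n₂) (ResidueField A)))) := by
    rw [span_range_prod_eq_top hτ₁ hτ₂ hτ]
    trivial
  suffices H : ∀ p ∈ Submodule.span (ResidueField A) (Set.range fun g =>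
      ((τ₁ g : Matrix (Fin n₁) (Fin n₁) (ResidueField A)),
        (τ₂ g : Matrix (Fin n₂) (Fin n₂) (ResidueField A)))),
      ∃ x b, (ρ x).map (residue A) = Matrix.fromBlocks p.1 b 0 p.2 from H _ hmem
  intro p hp
  induction hp using Submodule.span_induction with
  | mem p hp =>
    obtain ⟨g, rfl⟩ := hp
    obtain ⟨b, hb⟩ := h g
    exact ⟨_, b, hb⟩
  | zero => exact ⟨0, 0, by ext i j; simp⟩
  | add p q _ _ hp hq =>
    obtain ⟨x, b, hx⟩ := hp
    obtain ⟨y, c, hy⟩ := hq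
    refine ⟨x + y, b + c, ?_⟩
    rw [map_add, Matrix.map_add _ (map_add _), hx, hy, Matrix.fromBlocks_add]
    simp
  | smul c p _ hp =>
    obtain ⟨x, b, hx⟩ := hp
    obtain ⟨c, rfl⟩ := residue_surjective c
    refine ⟨c • x, residue A c • b, ?_⟩
    rw [map_smul, Matrix.map_smul' _ c _ (map_mul _), hx, Matrix.fromBlocks_smul]
    simp

theorem HasReduction.exists_map_eq (h : HasReduction ρ τ₁ τ₂) (x : A[G]) :
    ∃ M₁ b M₂, (ρ x).map (residue A) = Matrix.fromBlocks M₁ b 0 M₂ := by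
  induction x using MonoidAlgebra.induction_linear with
  | zero => exact ⟨0, 0, 0, by ext i j; simp⟩
  | add x y hx hy =>
    obtain ⟨M₁, b, M₂, hx⟩ := hx
    obtain ⟨N₁, c, N₂, hy⟩ := hy
    refine ⟨M₁ + N₁, b + c, M₂ + N₂, ?_⟩
    rw [map_add, Matrix.map_add _ (map_add _), hx, hy, Matrix.fromBlocks_add]
    simp
  | single g c =>
    obtain ⟨b, hb⟩ := h g
    refine ⟨residue A c • (τ₁ g : Matrix (Fin n₁) (Fin n₁) (ResidueField A)), residue A c • b,
      residue A c • (τ₂ g : Matrix (Fin n₂) (Fin n₂) (ResidueField A)), ?_⟩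
    rw [show (MonoidAlgebra.single g c : A[G]) = c • MonoidAlgebra.of A G g by simp,
      map_smul, Matrix.map_smul' _ c _ (map_mul _), hb, Matrix.fromBlocks_smul, smul_zero]

theorem HasReduction.apply_inr_inl_mem (h : HasReduction ρ τ₁ τ₂) (x : A[G]) (i : Fin n₂)
    (j : Fin n₁) : ρ x (Sum.inr i) (Sum.inl j) ∈ maximalIdeal A := by
  obtain ⟨M₁, b, M₂, hx⟩ := h.exists_map_eq x
  rw [← residue_eq_zero_iff]
  exact congrFun (congrFun hx (Sum.inr i)) (Sum.inl j)

/-- The representation `σ` has reduction `[[τ₁, *], [0, τ₂]]`, and its image consists of all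
matrices with lower left block in the ideal `C`. -/
structure IsStandard (σ : A[G] →ₐ[A] Matrix (Fin n₁ ⊕ Fin n₂) (Fin n₁ ⊕ Fin n₂) A)
    (τ₁ : G →* GL (Fin n₁) (ResidueField A)) (τ₂ : G →* GL (Fin n₂) (ResidueField A))
    (C : Ideal A) : Prop where
  hasReduction : HasReduction σ τ₁ τ₂
  exists_apply_eq : ∀ M : Matrix (Fin n₁ ⊕ Fin n₂) (Fin n₁ ⊕ Fin n₂) A,
    (∀ i j, M (Sum.inr i) (Sum.inl j) ∈ C) → ∃ x, σ x = M
  apply_mem : ∀ x i j, σ x (Sum.inr i) (Sum.inl j) ∈ C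

theorem IsStandard.le_maximalIdeal {σ : A[G] →ₐ[A] Matrix (Fin n₁ ⊕ Fin n₂) (Fin n₁ ⊕ Fin n₂) A}
    {C : Ideal A} (h : IsStandard σ τ₁ τ₂ C) (hn₁ : 0 < n₁) (hn₂ : 0 < n₂) :
    C ≤ maximalIdeal A := fun c hc => by
  obtain ⟨x, hx⟩ := h.exists_apply_eq (Matrix.of fun _ _ => c) (fun _ _ => hc)
  have := h.hasReduction.apply_inr_inl_mem x ⟨0, hn₂⟩ ⟨0, hn₁⟩
  rwa [hx] at this

theorem HasReduction.conjHom {P Q : Matrix (Fin n₁ ⊕ Fin n₂) (Fin n₁ ⊕ Fin n₂) A}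
    {β : Matrix (Fin n₁) (Fin n₂) (ResidueField A)}
    (h : HasReduction ρ τ₁ τ₂) (hPQ : P * Q = 1) (hQP : Q * P = 1)
    (hP : P.map (residue A) = Matrix.fromBlocks 1 β 0 1)
    (hQ : Q.map (residue A) = Matrix.fromBlocks 1 (-β) 0 1) :
    HasReduction (conjHom ρ hPQ hQP) τ₁ τ₂ := fun g => by
  obtain ⟨b, hb⟩ := h g
  rw [conjHom_apply, Matrix.map_mul, Matrix.map_mul, hb, hP, hQ, Matrix.fromBlocks_multiply,
    Matrix.fromBlocks_multiply]
  refine ⟨(τ₁ g : Matrix (Fin n₁) (Fin n₁) (ResidueField A)) * β +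
    (b + -(β * (τ₂ g : Matrix (Fin n₂) (Fin n₂) (ResidueField A)))), ?_⟩
  simp

theorem map_inverse_eq_fromBlocks {P Q : Matrix (Fin n₁ ⊕ Fin n₂) (Fin n₁ ⊕ Fin n₂) A}
    {β : Matrix (Fin n₁) (Fin n₂) (ResidueField A)} (hQP : Q * P = 1)
    (hP : P.map (residue A) = Matrix.fromBlocks 1 β 0 1) :
    Q.map (residue A) = Matrix.fromBlocks 1 (-β) 0 1 := by
  have h1 : Q.map (residue A) * P.map (residue A) = 1 := by
    rw [← Matrix.map_mul, hQP]
    exact Matrix.map_one _ (map_zero _) (map_one _)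
  have h2 : P.map (residue A) * Matrix.fromBlocks 1 (-β) 0 1 = 1 := by
    rw [hP, Matrix.fromBlocks_multiply]
    simp
  exact left_inv_eq_right_inv h1 h2

/-- If the reduction of a conjugate of `ρ` is block diagonal, the extension class of `ρ`
vanishes. -/
theorem HasReduction.extClass_eq_zero_of_conj (h : HasReduction ρ τ₁ τ₂)
    {P Q : Matrix (Fin n₁ ⊕ Fin n₂) (Fin n₁ ⊕ Fin n₂) A}
    {β : Matrix (Fin n₁) (Fin n₂) (ResidueField A)} (hPQ : P * Q = 1) (hQP : Q * P = 1)
    (hQ : Q.map (residue A) = Matrix.fromBlocks 1 β 0 1)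
    (hdiag : ∀ g, (RedIdeal.conjHom ρ hPQ hQP (MonoidAlgebra.of A G g)).map (residue A) =
      Matrix.fromBlocks (τ₁ g : Matrix (Fin n₁) (Fin n₁) (ResidueField A)) 0 0
        (τ₂ g : Matrix (Fin n₂) (Fin n₂) (ResidueField A))) :
    h.extClass = 0 := by
  let r : (redRep ρ).IntertwiningMap (vecRep τ₁) :=
    { toFun := fun v => ((Q.map (residue A)).mulVec v) ∘ Sum.inl
      map_add' := fun v w => by rw [Matrix.mulVec_add]; rfl
      map_smul' := fun c v => by rw [Matrix.mulVec_smul]; rfl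
      isIntertwining' := fun g => by
        refine LinearMap.ext fun v => ?_
        change (Q.map (residue A)).mulVec
          (((ρ (MonoidAlgebra.of A G g)).map (residue A)).mulVec v) ∘ Sum.inl =
          (τ₁ g : Matrix _ _ _).mulVec ((Q.map (residue A)).mulVec v ∘ Sum.inl)
        have h1 : Q * ρ (MonoidAlgebra.of A G g) =
            RedIdeal.conjHom ρ hPQ hQP (MonoidAlgebra.of A G g) * Q := by
          rw [conjHom_apply, mul_assoc, hPQ, mul_one]
        rw [Matrix.mulVec_mulVec, ← Matrix.map_mul, h1, Matrix.map_mul, hdiag,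
          ← Matrix.mulVec_mulVec, Matrix.fromBlocks_mulVec]
        simp }
  refine IsShortExact.extClass_eq_zero h.isShortExact r fun v => ?_
  change (Q.map (residue A)).mulVec (Sum.elim v 0) ∘ Sum.inl = v
  rw [hQ, Matrix.fromBlocks_mulVec]
  simp

/-- After a change of basis, the image of a residually multiplicity free representation with
non-split reduction consists of all matrices with lower left block in some ideal.
As `n!` is invertible, the entries `0, 1, …, n - 1` of a diagonal matrix are residually distinct;
an element of `A[G]` with this semisimplified reduction is diagonalizable, and the projectors to
its eigenspaces lie in the image. -/
theorem exists_isStandard_conj [IsAdicComplete (maximalIdeal A) A]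
    (hn : IsUnit ((Nat.factorial (n₁ + n₂) : ℕ) : A))
    (hτ₁ : IsAbsIrreducible τ₁) (hτ₂ : IsAbsIrreducible τ₂)
    (hτ : IsEmpty ((vecRep τ₁).Equiv (vecRep τ₂)))
    (hρ : HasReduction ρ τ₁ τ₂) (hρ0 : hρ.extClass ≠ 0) :
    ∃ (P Q : Matrix (Fin n₁ ⊕ Fin n₂) (Fin n₁ ⊕ Fin n₂) A) (hPQ : P * Q = 1) (hQP : Q * P = 1)
      (C : Ideal A), IsStandard (conjHom ρ hPQ hQP) τ₁ τ₂ C := by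
  classical
  set c : Fin n₁ ⊕ Fin n₂ → A := fun i => ((finSumFinEquiv i : ℕ) : A) with hc
  have hcu : ∀ i j, i ≠ j → IsUnit (c i - c j) := fun i j hij => by
    have hne : (finSumFinEquiv i : ℕ) ≠ finSumFinEquiv j := fun h =>
      hij (finSumFinEquiv.injective (Fin.ext h))
    rcases lt_or_gt_of_ne hne with h | h
    · rw [← neg_sub]
      exact (isUnit_sub_of_factorial hn (finSumFinEquiv j).2 h).neg
    · exact isUnit_sub_of_factorial hn (finSumFinEquiv i).2 h
  obtain ⟨x, b, hx⟩ := hρ.exists_map_eq_fromBlocks hτ₁ hτ₂ hτ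
    (Matrix.diagonal fun i => residue A (c (Sum.inl i)))
    (Matrix.diagonal fun i => residue A (c (Sum.inr i)))
  obtain ⟨P, Q, a, β, hPQ, hQP, hau, hxP, hP⟩ := exists_diagonalization (ρ x) hcu hx
  have hQ := map_inverse_eq_fromBlocks hQP hP
  set σ := conjHom ρ hPQ hQP with hσ
  have hred : HasReduction σ τ₁ τ₂ := hρ.conjHom hPQ hQP hP hQ
  have hσx : σ x = Matrix.diagonal a := by
    rw [hσ, conjHom_apply, mul_assoc, hxP, ← mul_assoc, hQP, one_mul]
  have hdiag : ∀ i, cornerIdeal σ i i = ⊤ := fun i => by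
    rw [Ideal.eq_top_iff_one, mem_cornerIdeal]
    refine ⟨Polynomial.aeval x (interpolation a i), ?_⟩
    change σ _ = _
    rw [← Polynomial.aeval_algHom_apply, hσx, aeval_diagonal]
    simp only [eval_interpolation hau]
    ext r s
    simp only [Matrix.diagonal_apply, Matrix.single_apply]
    grind
  have hmem := mem_range_iff_of_diag hdiag
  have htop : ∀ i j, (∃ y, IsUnit (residue A (σ y i j))) → cornerIdeal σ i j = ⊤ := by
    rintro i j ⟨y, hy⟩
    exact Ideal.eq_top_of_isUnit_mem _ ((hmem (σ y)).1 ⟨y, rfl⟩ i j)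
      ((isUnit_map_iff (residue A) _).1 hy)
  have h11 : ∀ i j, cornerIdeal σ (Sum.inl i) (Sum.inl j) = ⊤ := fun i j => by
    obtain ⟨y, b, hy⟩ := hred.exists_map_eq_fromBlocks hτ₁ hτ₂ hτ (Matrix.of fun _ _ => 1) 0
    refine htop _ _ ⟨y, ?_⟩
    have := congrFun (congrFun hy (Sum.inl i)) (Sum.inl j)
    rw [Matrix.map_apply] at this
    rw [this]
    simp
  have h22 : ∀ i j, cornerIdeal σ (Sum.inr i) (Sum.inr j) = ⊤ := fun i j => by
    obtain ⟨y, b, hy⟩ := hred.exists_map_eq_fromBlocks hτ₁ hτ₂ hτ 0 (Matrix.of fun _ _ => 1)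
    refine htop _ _ ⟨y, ?_⟩
    have := congrFun (congrFun hy (Sum.inr i)) (Sum.inr j)
    rw [Matrix.map_apply] at this
    rw [this]
    simp
  -- some upper right entry is a unit, as otherwise the reduction of `σ` would be block diagonal
  have h12 : ∀ i j, cornerIdeal σ (Sum.inl i) (Sum.inr j) = ⊤ := fun i j => by
    by_contra hne
    refine hρ0 (hρ.extClass_eq_zero_of_conj hPQ hQP hQ fun g => ?_)
    obtain ⟨b, hb⟩ := hred g
    have hb0 : b = 0 := by
      ext i' j'
      by_contra hb0
      have hij := htop (Sum.inl i') (Sum.inr j') ⟨MonoidAlgebra.of A G g, by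
        have := congrFun (congrFun hb (Sum.inl i')) (Sum.inr j')
        rw [Matrix.map_apply] at this
        rw [this]
        exact isUnit_iff_ne_zero.2 hb0⟩
      exact hne (top_le_iff.1 (hij.ge.trans (cornerIdeal_le_of_eq_top (h11 i i') (h22 j' j))))
    rw [hb0] at hb
    exact hb
  refine ⟨P, Q, hPQ, hQP, cornerIdeal σ (Sum.inr ⟨0, hτ₂.pos⟩) (Sum.inl ⟨0, hτ₁.pos⟩), hred,
    fun M hM => ?_, fun y i j => ?_⟩
  · refine (hmem M).2 fun i j => ?_
    rcases i with i | i <;> rcases j with j | j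
    · rw [h11]; trivial
    · rw [h12]; trivial
    · exact cornerIdeal_le_of_eq_top (h22 _ _) (h11 _ _) (hM i j)
    · rw [h22]; trivial
  · exact cornerIdeal_le_of_eq_top (h22 _ _) (h11 _ _) ((hmem (σ y)).1 ⟨y, rfl⟩ _ _)

end Image

/-! ### The ideal of reducibility -/

section Reducibility

open IsLocalRing

variable {G : Type u} [Group G] {A : Type u} [CommRing A] {n₁ n₂ : ℕ}

section BlockHom

variable (σ : A[G] →ₐ[A] Matrix (Fin n₁ ⊕ Fin n₂) (Fin n₁ ⊕ Fin n₂) A)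
  (B : Type*) [CommRing B] [Algebra A B]

/-- The upper left block of a representation, over an algebra over which it is block upper
triangular. -/
def blockHom₁ (h : ∀ x i j, algebraMap A B (σ x (Sum.inr i) (Sum.inl j)) = 0) :
    A[G] →ₐ[A] Matrix (Fin n₁) (Fin n₁) B :=
  AlgHom.ofLinearMap
    { toFun := fun x => Matrix.of fun i j => algebraMap A B (σ x (Sum.inl i) (Sum.inl j))
      map_add' := fun x y => by ext i j; simp
      map_smul' := fun c x => by
        ext i j
        change algebraMap A B (σ (c • x) _ _) = c • algebraMap A B (σ x _ _)
        rw [map_smul, Matrix.smul_apply, smul_eq_mul, map_mul, Algebra.smul_def] }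
    (by ext i j; simp [Matrix.one_apply, apply_ite (algebraMap A B)])
    (fun x y => by
      ext i j
      simp [Matrix.mul_apply, h])

/-- The lower right block of a representation, over an algebra over which it is block upper
triangular. -/
def blockHom₂ (h : ∀ x i j, algebraMap A B (σ x (Sum.inr i) (Sum.inl j)) = 0) :
    A[G] →ₐ[A] Matrix (Fin n₂) (Fin n₂) B :=
  AlgHom.ofLinearMap
    { toFun := fun x => Matrix.of fun i j => algebraMap A B (σ x (Sum.inr i) (Sum.inr j))
      map_add' := fun x y => by ext i j; simp
      map_smul' := fun c x => by
        ext i j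
        change algebraMap A B (σ (c • x) _ _) = c • algebraMap A B (σ x _ _)
        rw [map_smul, Matrix.smul_apply, smul_eq_mul, map_mul, Algebra.smul_def] }
    (by ext i j; simp [Matrix.one_apply, apply_ite (algebraMap A B)])
    (fun x y => by
      ext i j
      simp [Matrix.mul_apply, h])

variable {σ B}

theorem algebraMap_traceMap_eq_add
    (h : ∀ x i j, algebraMap A B (σ x (Sum.inr i) (Sum.inl j)) = 0) (x : A[G]) :
    algebraMap A B ((σ x).trace) =
      matTrace (blockHom₁ σ B h) x + matTrace (blockHom₂ σ B h) x := by
  simp [Matrix.trace, blockHom₁, blockHom₂]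

/-- Over an algebra over which the representation is block upper triangular, its trace is the sum
of the two pseudo-representations given by the diagonal blocks. -/
theorem isPseudorep_blockHom (hn : IsUnit ((Nat.factorial (n₁ + n₂) : ℕ) : A))
    (h : ∀ x i j, algebraMap A B (σ x (Sum.inr i) (Sum.inl j)) = 0) :
    IsPseudorep (matTrace (blockHom₁ σ B h)) n₁ ∧ IsPseudorep (matTrace (blockHom₂ σ B h)) n₂ := by
  have hu : ∀ d ≤ n₁ + n₂, IsUnit ((Nat.factorial d : ℕ) : B) := fun d hd => by
    obtain ⟨c, hc⟩ := Nat.factorial_dvd_factorial hd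
    have h1 := hn.map (algebraMap A B)
    rw [map_natCast, hc, Nat.cast_mul] at h1
    exact isUnit_of_mul_isUnit_left h1
  constructor
  · have := isPseudorep_matTrace (blockHom₁ σ B h)
      (by rw [Fintype.card_fin]; exact hu _ (by omega))
    rwa [Fintype.card_fin] at this
  · have := isPseudorep_matTrace (blockHom₂ σ B h)
      (by rw [Fintype.card_fin]; exact hu _ (by omega))
    rwa [Fintype.card_fin] at this

end BlockHom

theorem traceMap_conjHom [IsLocalRing A]
    (ρ : A[G] →ₐ[A] Matrix (Fin n₁ ⊕ Fin n₂) (Fin n₁ ⊕ Fin n₂) A)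
    {P Q : Matrix (Fin n₁ ⊕ Fin n₂) (Fin n₁ ⊕ Fin n₂) A} (hPQ : P * Q = 1) (hQP : Q * P = 1) :
    traceMap (conjHom ρ hPQ hQP) = traceMap ρ := by
  refine LinearMap.ext fun x => ?_
  change (Q * ρ x * P).trace = (ρ x).trace
  rw [Matrix.trace_mul_comm, ← mul_assoc, hPQ, one_mul]

/-- If `C` became zero at a point of the total ring of fractions, the trace would be reducible
there. -/
theorem map_fractionRing_eq_top [IsLocalRing A]
    {σ : A[G] →ₐ[A] Matrix (Fin n₁ ⊕ Fin n₂) (Fin n₁ ⊕ Fin n₂) A} {C : Ideal A}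
    (hn : IsUnit ((Nat.factorial (n₁ + n₂) : ℕ) : A)) (hn₁ : 0 < n₁) (hn₂ : 0 < n₂)
    (hC : ∀ x i j, σ x (Sum.inr i) (Sum.inl j) ∈ C)
    (hirr : ∀ (M : Ideal (FractionRing A)) [M.IsMaximal],
      IsAbsIrreduciblePseudorep ((Algebra.linearMap A M.ResidueField).comp (traceMap σ))) :
    C.map (algebraMap A (FractionRing A)) = ⊤ := by
  by_contra hne
  obtain ⟨M, hM, hle⟩ := Ideal.exists_le_maximal _ hne
  have h0 : ∀ x i j, algebraMap A (AlgebraicClosure M.ResidueField)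
      (σ x (Sum.inr i) (Sum.inl j)) = 0 := fun x i j => by
    rw [IsScalarTower.algebraMap_apply A M.ResidueField (AlgebraicClosure M.ResidueField),
      IsScalarTower.algebraMap_apply A (FractionRing A) M.ResidueField,
      Ideal.algebraMap_residueField_eq_zero.2 (hle (Ideal.mem_map_of_mem _ (hC x i j))),
      map_zero]
  obtain ⟨h1, h2⟩ := isPseudorep_blockHom hn h0
  refine hirr M ⟨n₁, n₂, _, _, hn₁, hn₂, h1, h2, fun x => ?_⟩
  rw [← algebraMap_traceMap_eq_add h0]
  exact (IsScalarTower.algebraMap_apply A M.ResidueField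
    (AlgebraicClosure M.ResidueField) _).symm

variable [IsLocalRing A] {σ : A[G] →ₐ[A] Matrix (Fin n₁ ⊕ Fin n₂) (Fin n₁ ⊕ Fin n₂) A}
  {τ₁ : G →* GL (Fin n₁) (ResidueField A)} {τ₂ : G →* GL (Fin n₂) (ResidueField A)}
  {C : Ideal A}

theorem IsStandard.isReducibleModulo (h : IsStandard σ τ₁ τ₂ C) (hn₁ : 0 < n₁) (hn₂ : 0 < n₂)
    (hn : IsUnit ((Nat.factorial (n₁ + n₂) : ℕ) : A)) :
    IsReducibleModulo (traceMap σ) τ₁ τ₂ C := by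
  have h0 : ∀ x i j, algebraMap A (A ⧸ C) (σ x (Sum.inr i) (Sum.inl j)) = 0 := fun x i j =>
    Ideal.Quotient.eq_zero_iff_mem.2 (h.apply_mem x i j)
  obtain ⟨h1, h2⟩ := isPseudorep_blockHom hn h0
  refine ⟨h.le_maximalIdeal hn₁ hn₂, _, _, h1, h2, algebraMap_traceMap_eq_add h0,
    fun g => ?_, fun g => ?_⟩
  · obtain ⟨b, hb⟩ := h.hasReduction g
    rw [matTrace_apply, Matrix.trace, map_sum]
    refine Finset.sum_congr rfl fun i _ => ?_
    exact congrFun (congrFun hb (Sum.inl i)) (Sum.inl i)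
  · obtain ⟨b, hb⟩ := h.hasReduction g
    rw [matTrace_apply, Matrix.trace, map_sum]
    refine Finset.sum_congr rfl fun i _ => ?_
    exact congrFun (congrFun hb (Sum.inr i)) (Sum.inr i)

theorem factor_apply_eq_mk {J : Ideal A} (hJ : J ≤ maximalIdeal A) {T : A[G] →ₗ[A] A ⧸ J}
    {t : A[G] →ₗ[A] A} (hT : ∀ g, Ideal.Quotient.factor hJ (T (MonoidAlgebra.of A G g)) =
      Ideal.Quotient.mk (maximalIdeal A) (t (MonoidAlgebra.of A G g))) (x : A[G]) :
    Ideal.Quotient.factor hJ (T x) = Ideal.Quotient.mk (maximalIdeal A) (t x) := by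
  induction x using MonoidAlgebra.induction_linear with
  | zero => rw [map_zero, map_zero, map_zero, map_zero]
  | add x y hx hy => rw [map_add, map_add, map_add, map_add, hx, hy]
  | single g c =>
    have h1 : ∀ b : A ⧸ J, c • b = Ideal.Quotient.mk J c * b := fun b => Algebra.smul_def c b
    rw [show (MonoidAlgebra.single g c : A[G]) = c • MonoidAlgebra.of A G g by simp,
      T.map_smul, t.map_smul, h1, map_mul, hT, smul_eq_mul, map_mul, Ideal.Quotient.factor_mk]

theorem mem_map_of_factor_eq_zero {J : Ideal A} (hJ : J ≤ maximalIdeal A) {b : A ⧸ J}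
    (hb : Ideal.Quotient.factor hJ b = 0) : b ∈ (maximalIdeal A).map (Ideal.Quotient.mk J) := by
  obtain ⟨a, rfl⟩ := Ideal.Quotient.mk_surjective b
  rw [Ideal.Quotient.factor_mk, Ideal.Quotient.eq_zero_iff_mem] at hb
  exact Ideal.mem_map_of_mem _ hb

/-- If the trace is the sum of two pseudo-representations modulo `J`, then `C ≤ J`: an element
`c` of `C` is the trace of a product through both diagonal idempotents, so its class modulo `J`
lies in all powers of the maximal ideal. -/
theorem IsStandard.le_of_isReducibleModulo [IsNoetherianRing A] (h : IsStandard σ τ₁ τ₂ C)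
    (hn₁ : 0 < n₁) (hn₂ : 0 < n₂) {J : Ideal A} (hJ : IsReducibleModulo (traceMap σ) τ₁ τ₂ J) :
    C ≤ J := by
  obtain ⟨hJm, T₁, T₂, h₁, h₂, hT, ht₁, ht₂⟩ := hJ
  intro c hc
  set I := (maximalIdeal A).map (Ideal.Quotient.mk J) with hI
  have hJtop : J ≠ ⊤ := fun hJt => (maximalIdeal.isMaximal A).ne_top (top_le_iff.1 (hJt ▸ hJm))
  have : Nontrivial (A ⧸ J) := Ideal.Quotient.nontrivial_iff.2 hJtop
  have : IsLocalRing (A ⧸ J) :=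
    .of_surjective' (Ideal.Quotient.mk J) Ideal.Quotient.mk_surjective
  have hItop : I ≠ ⊤ := by
    intro hIt
    have h1 := Ideal.comap_map_mk hJm
    rw [← hI, hIt, Ideal.comap_top] at h1
    exact (maximalIdeal.isMaximal A).ne_top h1.symm
  obtain ⟨x, hx⟩ := h.exists_apply_eq (Matrix.fromBlocks 1 0 0 0) (fun i j => C.zero_mem)
  -- `σ a` and `σ b` are elementary matrices with entries `1` and `c`, and `c` is the trace of their
  -- product
  obtain ⟨a, ha⟩ := h.exists_apply_eq
    (Matrix.fromBlocks 0 (Matrix.single ⟨0, hn₁⟩ ⟨0, hn₂⟩ 1) 0 0) (fun i j => C.zero_mem)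
  obtain ⟨b, hb⟩ := h.exists_apply_eq
    (Matrix.fromBlocks 0 0 (Matrix.single ⟨0, hn₂⟩ ⟨0, hn₁⟩ c) 0) (fun i j => by
      rw [Matrix.fromBlocks_apply₂₁, Matrix.single_apply]
      split_ifs
      · exact hc
      · exact C.zero_mem)
  have hx' : σ (1 - x) = Matrix.fromBlocks 0 0 0 1 := by
    rw [map_sub, map_one, hx, ← Matrix.fromBlocks_one, sub_eq_iff_eq_add,
      Matrix.fromBlocks_add]
    simp
  set t₁ : A[G] →ₗ[A] A :=
    ∑ i, (Matrix.entryLinearMap A A (Sum.inl i) (Sum.inl i)).comp σ.toLinearMap with ht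
  have ht₁' : ∀ y, t₁ y = ∑ i, σ y (Sum.inl i) (Sum.inl i) := fun y => by
    simp [ht, LinearMap.sum_apply]
  set t₂ : A[G] →ₗ[A] A :=
    ∑ i, (Matrix.entryLinearMap A A (Sum.inr i) (Sum.inr i)).comp σ.toLinearMap with ht'
  have ht₂' : ∀ y, t₂ y = ∑ i, σ y (Sum.inr i) (Sum.inr i) := fun y => by
    simp [ht', LinearMap.sum_apply]
  have hx₁ : ∀ y, T₁ ((1 - x) * y) ∈ I := fun y => by
    refine mem_map_of_factor_eq_zero hJm ?_
    rw [factor_apply_eq_mk (t := t₁) hJm fun g => (ht₁ g).trans ?_, ht₁', Finset.sum_eq_zero,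
      map_zero]
    · intro i _
      rw [map_mul, hx', Matrix.mul_apply]
      simp
    · obtain ⟨b, hb⟩ := h.hasReduction g
      change _ = residue A _
      rw [ht₁', map_sum]
      exact Finset.sum_congr rfl fun i _ =>
        (congrFun (congrFun hb (Sum.inl i)) (Sum.inl i)).symm
  have hx₂ : ∀ y, T₂ (x * y) ∈ I := fun y => by
    refine mem_map_of_factor_eq_zero hJm ?_
    rw [factor_apply_eq_mk (t := t₂) hJm fun g => (ht₂ g).trans ?_, ht₂', Finset.sum_eq_zero,
      map_zero]
    · intro i _
      rw [map_mul, hx, Matrix.mul_apply]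
      simp
    · obtain ⟨b, hb⟩ := h.hasReduction g
      change _ = residue A _
      rw [ht₂', map_sum]
      exact Finset.sum_congr rfl fun i _ =>
        (congrFun (congrFun hb (Sum.inr i)) (Sum.inr i)).symm
  have hidem : ∀ l, l ≠ 0 → σ (x ^ l) = Matrix.fromBlocks 1 0 0 0 := fun l hl => by
    rw [map_pow, hx]
    refine IsIdempotentElem.pow_eq ?_ hl
    rw [IsIdempotentElem, Matrix.fromBlocks_multiply]
    simp
  have hidem' : ∀ l, l ≠ 0 → σ ((1 - x) ^ l) = Matrix.fromBlocks 0 0 0 1 := fun l hl => by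
    rw [map_pow, hx']
    refine IsIdempotentElem.pow_eq ?_ hl
    rw [IsIdempotentElem, Matrix.fromBlocks_multiply]
    simp
  have hmem : ∀ N, Ideal.Quotient.mk J c ∈ I ^ N := fun N => by
    rcases Nat.eq_zero_or_pos N with rfl | hN
    · simp
    have h3 := apply_mul_mem_of_add h₁ h₂ hn₁ hn₂ hT hx₁ hx₂ N a b
    have h4 : traceMap σ (x ^ (n₂ * N) * a * ((1 - x) ^ (n₁ * N) * b)) = c := by
      change (σ _).trace = c
      rw [map_mul, map_mul, map_mul, hidem _ (by positivity), hidem' _ (by positivity), ha, hb]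
      simp [Matrix.fromBlocks_multiply, Matrix.trace, Matrix.single_apply]
    rwa [h4] at h3
  rw [← Ideal.Quotient.eq_zero_iff_mem]
  have h5 : Ideal.Quotient.mk J c ∈ ⨅ N, I ^ N := Ideal.mem_iInf.2 hmem
  rwa [Ideal.iInf_pow_eq_bot_of_isLocalRing I hItop] at h5

theorem IsStandard.reducibilityIdeal_eq [IsNoetherianRing A] (h : IsStandard σ τ₁ τ₂ C)
    (hn₁ : 0 < n₁) (hn₂ : 0 < n₂) (hn : IsUnit ((Nat.factorial (n₁ + n₂) : ℕ) : A)) :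
    reducibilityIdeal (traceMap σ) τ₁ τ₂ = C :=
  le_antisymm (sInf_le (h.isReducibleModulo hn₁ hn₂ hn))
    (le_sInf fun _ hJ => h.le_of_isReducibleModulo hn₁ hn₂ hJ)

end Reducibility

/-! ### The map `ι` of an Urban lattice -/

theorem algebraMap_smul_asModule {G : Type u} [Group G] {k : Type u} [Field k] {V : Type u}
    [AddCommGroup V] [Module k V] (σ : Representation k G V) (c : k) (v : V) :
    (algebraMap k k[G] c • σ.asModuleEquiv.symm v : σ.asModule) = σ.asModuleEquiv.symm (c • v) :=
  (σ.asModuleEquiv_symm_map_smul c v).symm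

theorem one_tmul_surjective {A : Type*} [CommRing A] [IsLocalRing A] {M : Type*} [AddCommGroup M]
    [Module A M] (x : IsLocalRing.ResidueField A ⊗[A] M) :
    ∃ m : M, (1 : IsLocalRing.ResidueField A) ⊗ₜ[A] m = x := by
  induction x using TensorProduct.induction_on with
  | zero => exact ⟨0, TensorProduct.tmul_zero _ _⟩
  | tmul c m =>
    obtain ⟨a, rfl⟩ := IsLocalRing.residue_surjective c
    refine ⟨a • m, ?_⟩
    rw [TensorProduct.tmul_smul, TensorProduct.smul_tmul', Algebra.smul_def, mul_one]
    rfl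
  | add x y hx hy =>
    obtain ⟨m, rfl⟩ := hx
    obtain ⟨n, rfl⟩ := hy
    exact ⟨m + n, TensorProduct.tmul_add _ _ _⟩

namespace UrbanLattice

open IsLocalRing CategoryTheory CategoryTheory.Abelian

variable {G : Type u} [Group G] {A : Type u} [CommRing A] [IsLocalRing A] {n₁ n₂ : ℕ}
  {ρ : A[G] →ₐ[A] Matrix (Fin n₁ ⊕ Fin n₂) (Fin n₁ ⊕ Fin n₂) A}
  {τ₁ : G →* GL (Fin n₁) (ResidueField A)} {τ₂ : G →* GL (Fin n₂) (ResidueField A)}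
  (𝓛 : UrbanLattice ρ τ₁ τ₂)

theorem contract_apply_tmul (f : Module.Dual (ResidueField A) (ResidueField A ⊗[A] 𝓛.𝒯))
    (v : Fin n₂ → ResidueField A) (t : ResidueField A ⊗[A] 𝓛.𝒯) :
    𝓛.contract f (v ⊗ₜ[ResidueField A] t) = f t • v := by
  change TensorProduct.rid _ _ (f.lTensor _ (v ⊗ₜ[ResidueField A] t)) = _
  rw [LinearMap.lTensor_tmul, TensorProduct.rid_tmul]

theorem contract_add_apply (f g : Module.Dual (ResidueField A) (ResidueField A ⊗[A] 𝓛.𝒯))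
    (x : (Fin n₂ → ResidueField A) ⊗[ResidueField A] (ResidueField A ⊗[A] 𝓛.𝒯)) :
    𝓛.contract (f + g) x = 𝓛.contract f x + 𝓛.contract g x := by
  induction x using TensorProduct.induction_on with
  | zero => simp
  | tmul v t => rw [contract_apply_tmul, contract_apply_tmul, contract_apply_tmul,
      LinearMap.add_apply, add_smul]
  | add x y hx hy => rw [map_add, hx, hy, map_add, map_add]; abel

theorem contract_smul_apply (c : ResidueField A)
    (f : Module.Dual (ResidueField A) (ResidueField A ⊗[A] 𝓛.𝒯))
    (x : (Fin n₂ → ResidueField A) ⊗[ResidueField A] (ResidueField A ⊗[A] 𝓛.𝒯)) :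
    𝓛.contract (c • f) x = c • 𝓛.contract f x := by
  induction x using TensorProduct.induction_on with
  | zero => simp
  | tmul v t => rw [contract_apply_tmul, contract_apply_tmul, LinearMap.smul_apply, smul_assoc]
  | add x y hx hy => rw [map_add, hx, hy, map_add, smul_add]

theorem toModHom_contract_add (f g : Module.Dual (ResidueField A) (ResidueField A ⊗[A] 𝓛.𝒯)) :
    toModHom (𝓛.contract (f + g)) = toModHom (𝓛.contract f) + toModHom (𝓛.contract g) := by
  ext x
  exact 𝓛.contract_add_apply f g x

open scoped ModuleCat in
theorem toModHom_contract_smul (c : ResidueField A)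
    (f : Module.Dual (ResidueField A) (ResidueField A ⊗[A] 𝓛.𝒯)) :
    toModHom (𝓛.contract (c • f)) =
      (Linear.homModule (R := ResidueField A) _ _).toSMul.smul c (toModHom (𝓛.contract f)) := by
  ext x
  exact (𝓛.contract_smul_apply c f x).trans
    (algebraMap_smul_asModule (vecRep τ₂) c (𝓛.contract f x)).symm

/-- The map `ι` as a linear map. -/
def ιₗ : Module.Dual (ResidueField A) (ResidueField A ⊗[A] 𝓛.𝒯) →ₗ[ResidueField A]
    ExtOne (vecRep τ₁) (vecRep τ₂) where
  toFun := 𝓛.ι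
  map_add' f g := by
    rw [ι, ι, ι, toModHom_contract_add, Ext.mk₀_add, Ext.comp_add]
  map_smul' c f := by
    rw [ι, ι, toModHom_contract_smul]
    exact (congrArg (fun t => 𝓛.isShortExact.extClass.comp t (add_zero 1))
      (Ext.mk₀_smul c _)).trans (Ext.comp_smul _ _ _ c)

/-- If `ι f = 0`, the map `1 ⊗ f` extends to the whole reduction of the lattice, which for `f ≠ 0`
would give a quotient isomorphic to `τ₂`. -/
theorem ι_injective : Function.Injective 𝓛.ι := by
  change Function.Injective 𝓛.ιₗ
  rw [injective_iff_map_eq_zero]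
  intro f hf
  by_contra hne
  obtain ⟨r, hr⟩ := 𝓛.isShortExact.exists_extension (𝓛.contract f) hf
  obtain ⟨t, ht⟩ : ∃ t, f t ≠ 0 := by
    by_contra h
    push Not at h
    exact hne (LinearMap.ext h)
  refine 𝓛.no_quotient ⟨(r.toLinearMap.restrictScalars A).comp
    (TensorProduct.mk A (ResidueField A) 𝓛.L.toSubmodule 1), fun w => ?_, fun g v => ?_⟩
  · obtain ⟨v, hv⟩ := one_tmul_surjective
      (𝓛.incl (((f t)⁻¹ • w) ⊗ₜ[ResidueField A] t))
    refine ⟨v, ?_⟩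
    change r ((1 : ResidueField A) ⊗ₜ[A] v) = w
    rw [hv, hr, contract_apply_tmul, smul_smul, mul_inv_cancel₀ ht, one_smul]
  · exact LinearMap.congr_fun (r.isIntertwining' g) ((1 : ResidueField A) ⊗ₜ[A] v)

/-- If the image of `ι` lies in a line, then `𝒯/𝔪𝒯` is at most one-dimensional. -/
theorem finrank_le_one {S : Submodule (ResidueField A) (ExtOne (vecRep τ₁) (vecRep τ₂))}
    (hS : Module.finrank (ResidueField A) S = 1) (hι : Set.range 𝓛.ι ⊆ S) :
    Module.finrank (ResidueField A) (ResidueField A ⊗[A] 𝓛.𝒯) ≤ 1 := by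
  have := Module.finite_of_finrank_pos (R := ResidueField A) (M := S) (by omega)
  rw [← Subspace.dual_finrank_eq, ← hS]
  exact LinearMap.finrank_le_finrank_of_injective
    (f := 𝓛.ιₗ.codRestrict S fun f => hι ⟨f, rfl⟩)
    fun f g hfg => 𝓛.ι_injective (congrArg Subtype.val hfg)

theorem finrank_reduction [IsNoetherianRing A] :
    Module.finrank (ResidueField A) (ResidueField A ⊗[A] 𝓛.L.toSubmodule) =
      n₁ + n₂ * Module.finrank (ResidueField A) (ResidueField A ⊗[A] 𝓛.𝒯) := by
  have := 𝓛.isLattice_L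
  have : Module.Finite A 𝓛.L.toSubmodule := Submodule.IsLattice.finite (FractionRing A) _
  have h1 := LinearMap.finrank_range_add_finrank_ker 𝓛.proj.toLinearMap
  have h2 : LinearMap.range 𝓛.proj.toLinearMap = ⊤ :=
    LinearMap.range_eq_top.2 𝓛.isShortExact.surjective
  have h3 : LinearMap.ker 𝓛.proj.toLinearMap = LinearMap.range 𝓛.incl.toLinearMap :=
    LinearMap.exact_iff.1 𝓛.isShortExact.exact
  rw [h2, finrank_top, h3, LinearMap.finrank_range_of_inj 𝓛.isShortExact.injective,
    Module.finrank_tensorProduct, Module.finrank_fin_fun, Module.finrank_fin_fun] at h1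
  exact h1.symm

end UrbanLattice

/-! ### Lattices stable under a standard image -/

section StableLattice

open IsLocalRing

variable {A : Type u} [CommRing A] {n₁ n₂ : ℕ} {C : Ideal A}

/-- The lattice `L` is stable under all matrices over `A` with lower left block in `C`. -/
def IsStableLattice (C : Ideal A) (L : Submodule A (Fin n₁ ⊕ Fin n₂ → FractionRing A)) : Prop :=
  ∀ M : Matrix (Fin n₁ ⊕ Fin n₂) (Fin n₁ ⊕ Fin n₂) A,
    (∀ i j, M (Sum.inr i) (Sum.inl j) ∈ C) → ∀ v ∈ L,
      (M.map (algebraMap A (FractionRing A))).mulVec v ∈ L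

/-- The elements `t` such that the vector with the only non-zero coordinate `t` at `i` lies in
`L`. -/
def coordLattice {ι : Type*} [DecidableEq ι] (L : Submodule A (ι → FractionRing A)) (i : ι) :
    Submodule A (FractionRing A) :=
  L.comap (LinearMap.single A (fun _ => FractionRing A) i)

theorem mem_coordLattice {ι : Type*} [DecidableEq ι] {L : Submodule A (ι → FractionRing A)} {i : ι}
    {t : FractionRing A} : t ∈ coordLattice L i ↔ Pi.single i t ∈ L := Iff.rfl

theorem map_single_mulVec {ι : Type*} [Fintype ι] [DecidableEq ι] (i j : ι) (c : A)
    (v : ι → FractionRing A) :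
    ((Matrix.single i j c).map (algebraMap A (FractionRing A))).mulVec v =
      Pi.single i (c • v j) := by
  funext l
  rw [Matrix.mulVec, dotProduct, Finset.sum_eq_single j]
  · by_cases h : i = l
    · subst h
      simp [Algebra.smul_def]
    · simp [h]
  · intro b _ hb
    simp [hb.symm]
  · simp

namespace IsStableLattice

variable {L : Submodule A (Fin n₁ ⊕ Fin n₂ → FractionRing A)} (hL : IsStableLattice C L)

include hL

theorem single_mem {i j : Fin n₁ ⊕ Fin n₂} {c : A}
    (hc : ∀ a b, i = Sum.inr a → j = Sum.inl b → c ∈ C)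
    {v : Fin n₁ ⊕ Fin n₂ → FractionRing A} (hv : v ∈ L) : Pi.single i (c • v j) ∈ L := by
  rw [← map_single_mulVec]
  refine hL _ (fun a b => ?_) v hv
  rw [Matrix.single_apply]
  split_ifs with h
  · exact hc a b h.1 h.2
  · exact C.zero_mem

theorem mem_iff {v : Fin n₁ ⊕ Fin n₂ → FractionRing A} :
    v ∈ L ↔ ∀ i, v i ∈ coordLattice L i := by
  constructor
  · intro hv i
    rw [mem_coordLattice]
    simpa using hL.single_mem (i := i) (j := i) (c := 1)
      (fun a b h1 h2 => by simp [h1] at h2) hv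
  · intro hv
    rw [← Finset.univ_sum_single v]
    exact sum_mem fun i _ => hv i

theorem smul_mem_coordLattice {i j : Fin n₁ ⊕ Fin n₂} {c : A}
    (hc : ∀ a b, i = Sum.inr a → j = Sum.inl b → c ∈ C) {t : FractionRing A}
    (ht : t ∈ coordLattice L j) : c • t ∈ coordLattice L i := by
  rw [mem_coordLattice] at *
  simpa using hL.single_mem hc ht

theorem coordLattice_le {i j : Fin n₁ ⊕ Fin n₂}
    (hij : ∀ a b, i = Sum.inr a → j = Sum.inl b → False) :
    coordLattice L j ≤ coordLattice L i := fun t ht => by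
  simpa using hL.smul_mem_coordLattice (c := 1) (fun a b h1 h2 => (hij a b h1 h2).elim) ht

/-- A stable lattice is the product of its coordinate lattices. -/
def equivPi : L ≃ₗ[A] ∀ i, coordLattice L i where
  toFun v i := ⟨(v : _ → FractionRing A) i, hL.mem_iff.1 v.2 i⟩
  invFun w := ⟨fun i => w i, hL.mem_iff.2 fun i => (w i).2⟩
  map_add' _ _ := rfl
  map_smul' _ _ := rfl
  left_inv _ := rfl
  right_inv _ := rfl

theorem finite_coordLattice (hfg : L.FG) (i : Fin n₁ ⊕ Fin n₂) :
    Module.Finite A (coordLattice L i) := by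
  have : Module.Finite A L := Module.Finite.iff_fg.2 hfg
  exact Module.Finite.of_surjective
    ((LinearMap.proj (φ := fun i => coordLattice L i) i).comp hL.equivPi.toLinearMap)
    ((Function.surjective_eval i).comp hL.equivPi.surjective)

theorem eq_top_of_coordLattice_le
    (hspan : Submodule.span (FractionRing A) (L : Set (Fin n₁ ⊕ Fin n₂ → FractionRing A)) = ⊤)
    {i : Fin n₁ ⊕ Fin n₂} {I : Ideal (FractionRing A)} (hI : ∀ t ∈ coordLattice L i, t ∈ I) :
    I = ⊤ := by
  have hle : Submodule.span (FractionRing A) (L : Set (Fin n₁ ⊕ Fin n₂ → FractionRing A)) ≤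
      Submodule.comap (LinearMap.proj i : (Fin n₁ ⊕ Fin n₂ → FractionRing A) →ₗ[_] _) I :=
    Submodule.span_le.2 fun v hv => hI _ (hL.mem_iff.1 hv i)
  rw [hspan] at hle
  exact (Ideal.eq_top_iff_one I).2 (hle (x := fun _ => 1) trivial)

end IsStableLattice

variable [IsLocalRing A]

theorem exists_span_singleton_eq_of_finrank_eq_one {L : Submodule A (FractionRing A)}
    [Module.Finite A L]
    (h : Module.finrank (ResidueField A) (ResidueField A ⊗[A] L) = 1) :
    ∃ α, L = Submodule.span A {α} := by
  have : Nontrivial (ResidueField A ⊗[A] L) :=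
    Module.nontrivial_of_finrank_pos (R := ResidueField A) (by omega)
  obtain ⟨x, hx⟩ := exists_ne (0 : ResidueField A ⊗[A] L)
  obtain ⟨m, rfl⟩ := one_tmul_surjective x
  have hspan := IsLocalRing.span_eq_top_of_tmul_eq_basis (R := A) (M := L) (fun _ : Unit => m)
    (FiniteDimensional.basisSingleton Unit h _ hx) (fun _ => by simp)
  refine ⟨m, ?_⟩
  have h2 := congrArg (Submodule.map L.subtype) hspan
  rw [Submodule.map_span, Submodule.map_top, Submodule.range_subtype] at h2
  refine h2.symm.trans (congrArg _ ?_)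
  ext t
  simp

theorem finrank_tensor_pi {ι : Type*} [Fintype ι] [DecidableEq ι] (M : ι → Type*)
    [∀ i, AddCommGroup (M i)] [∀ i, Module A (M i)] [∀ i, Module.Finite A (M i)] :
    Module.finrank (ResidueField A) (ResidueField A ⊗[A] (∀ i, M i)) =
      ∑ i, Module.finrank (ResidueField A) (ResidueField A ⊗[A] M i) := by
  rw [← Module.finrank_pi_fintype (ResidueField A)]
  exact LinearEquiv.finrank_eq (TensorProduct.piRight A (ResidueField A) (ResidueField A) M)

/-- A stable lattice whose reduction has dimension at most `n₁ + n₂` has principal coordinate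
lattices. -/
theorem IsStableLattice.exists_coordLattice_eq
    {L : Submodule A (Fin n₁ ⊕ Fin n₂ → FractionRing A)} (hL : IsStableLattice C L)
    (hn₁ : 0 < n₁) (hn₂ : 0 < n₂) (hfg : L.FG)
    (hspan : Submodule.span (FractionRing A) (L : Set (Fin n₁ ⊕ Fin n₂ → FractionRing A)) = ⊤)
    (hrank : Module.finrank (ResidueField A) (ResidueField A ⊗[A] L) ≤ n₁ + n₂) :
    ∃ α β : (FractionRing A)ˣ, (∀ i, coordLattice L (Sum.inl i) = Submodule.span A {↑α}) ∧
      ∀ i, coordLattice L (Sum.inr i) = Submodule.span A {↑β} := by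
  have := hL.finite_coordLattice hfg
  have h1 : ∀ i, coordLattice L (Sum.inl i) = coordLattice L (Sum.inl ⟨0, hn₁⟩) := fun i =>
    le_antisymm (hL.coordLattice_le (by simp)) (hL.coordLattice_le (by simp))
  have h2 : ∀ i, coordLattice L (Sum.inr i) = coordLattice L (Sum.inr ⟨0, hn₂⟩) := fun i =>
    le_antisymm (hL.coordLattice_le (by simp)) (hL.coordLattice_le (by simp))
  have hd1 : ∀ i, Module.finrank (ResidueField A)
      (ResidueField A ⊗[A] coordLattice L (Sum.inl i)) = Module.finrank (ResidueField A)
      (ResidueField A ⊗[A] coordLattice L (Sum.inl ⟨0, hn₁⟩)) := fun i => by rw [h1 i]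
  have hd2 : ∀ i, Module.finrank (ResidueField A)
      (ResidueField A ⊗[A] coordLattice L (Sum.inr i)) = Module.finrank (ResidueField A)
      (ResidueField A ⊗[A] coordLattice L (Sum.inr ⟨0, hn₂⟩)) := fun i => by rw [h2 i]
  have hpos : ∀ i, 0 < Module.finrank (ResidueField A) (ResidueField A ⊗[A] coordLattice L i) := by
    intro i
    rw [Nat.pos_iff_ne_zero]
    intro h0
    rw [Module.finrank_zero_iff, IsLocalRing.subsingleton_tensorProduct] at h0
    have hbt : (⊥ : Ideal (FractionRing A)) = ⊤ :=
      hL.eq_top_of_coordLattice_le hspan (i := i) fun t ht => by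
        have : (⟨t, ht⟩ : coordLattice L i) = 0 := Subsingleton.elim _ _
        simpa using congrArg Subtype.val this
    exact bot_ne_top hbt
  have hsum : Module.finrank (ResidueField A) (ResidueField A ⊗[A] L) =
      ∑ i, Module.finrank (ResidueField A) (ResidueField A ⊗[A] coordLattice L i) := by
    rw [← finrank_tensor_pi]
    exact LinearEquiv.finrank_eq (hL.equivPi.baseChange A (ResidueField A) _ _)
  rw [hsum, Fintype.sum_sum_type] at hrank
  rw [Finset.sum_congr rfl fun i _ => hd1 i, Finset.sum_congr rfl fun i _ => hd2 i,
    Finset.sum_const, Finset.sum_const, Finset.card_univ, Finset.card_univ, Fintype.card_fin,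
    Fintype.card_fin, smul_eq_mul, smul_eq_mul] at hrank
  have hp1 := hpos (Sum.inl ⟨0, hn₁⟩)
  have hp2 := hpos (Sum.inr ⟨0, hn₂⟩)
  have hunit : ∀ i, Module.finrank (ResidueField A) (ResidueField A ⊗[A] coordLattice L i) = 1 →
      ∃ α : (FractionRing A)ˣ, coordLattice L i = Submodule.span A {↑α} := by
    intro i hi
    obtain ⟨α, hα⟩ := exists_span_singleton_eq_of_finrank_eq_one hi
    have hαt : Ideal.span {α} = ⊤ := hL.eq_top_of_coordLattice_le hspan (i := i) fun t ht => by
      rw [hα, Submodule.mem_span_singleton] at ht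
      obtain ⟨a, rfl⟩ := ht
      rw [Algebra.smul_def]
      exact Ideal.mul_mem_left _ _ (Ideal.mem_span_singleton_self α)
    obtain ⟨α, rfl⟩ := Ideal.span_singleton_eq_top.1 hαt
    exact ⟨α, hα⟩
  -- with `d₁, d₂ > 0` the bound `n₁ d₁ + n₂ d₂ ≤ n₁ + n₂` forces `d₁ = d₂ = 1`
  obtain ⟨α, hα⟩ := hunit (Sum.inl ⟨0, hn₁⟩) (by nlinarith)
  obtain ⟨β, hβ⟩ := hunit (Sum.inr ⟨0, hn₂⟩) (by nlinarith)
  exact ⟨α, β, fun i => (h1 i).trans hα, fun i => (h2 i).trans hβ⟩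

end StableLattice

/-! ### Principality from a line of extensions -/

section Quotient

open IsLocalRing

variable {A : Type u} [CommRing A] {C : Ideal A}

/-- If `C α ⊆ A β` and some `c₀ α` with `c₀ ∈ C` generates `A β`, then `c₀` generates `C`. -/
theorem isPrincipal_of_smul_eq {α β : (FractionRing A)ˣ}
    (hC : ∀ c ∈ C, ∃ r : A, c • (α : FractionRing A) = r • (β : FractionRing A)) {c₀ r₀ : A}
    (hc₀ : c₀ ∈ C) (hr₀ : IsUnit r₀) (h : c₀ • (α : FractionRing A) = r₀ • (β : FractionRing A)) :
    C.IsPrincipal := by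
  obtain ⟨u, rfl⟩ := hr₀
  refine ⟨c₀, le_antisymm (fun c hc => ?_) ((Ideal.span_singleton_le_iff_mem _).2 hc₀)⟩
  obtain ⟨r, hr⟩ := hC c hc
  refine Ideal.mem_span_singleton'.2 ⟨r * ↑u⁻¹, ?_⟩
  have h1 : (r * ↑u⁻¹ * c₀) • (α : FractionRing A) = c • (α : FractionRing A) := by
    rw [mul_smul, h, smul_smul, hr, mul_assoc, Units.inv_mul, mul_one]
  rw [Algebra.smul_def, Algebra.smul_def] at h1
  exact IsFractionRing.injective A (FractionRing A) (α.isUnit.mul_right_cancel h1)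

variable [IsLocalRing A] {n₁ n₂ : ℕ}

/-- A stable lattice `(Aα)^n₁ × (Aβ)^n₂` with `C α ⊆ 𝔪 β` has the quotient `(Aβ/𝔪β)^n₂`, on which
matrices act through the reduction of their lower right block. -/
theorem IsStableLattice.exists_quotient
    {L : Submodule A (Fin n₁ ⊕ Fin n₂ → FractionRing A)} (hL : IsStableLattice C L)
    {α β : (FractionRing A)ˣ} (hα : ∀ i, coordLattice L (Sum.inl i) = Submodule.span A {↑α})
    (hβ : ∀ i, coordLattice L (Sum.inr i) = Submodule.span A {↑β})
    (hC : ∀ c ∈ C, ∃ r ∈ maximalIdeal A, c • (α : FractionRing A) = r • (β : FractionRing A)) :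
    ∃ π : L →ₗ[A] (Fin n₂ → ResidueField A), Function.Surjective π ∧
      ∀ (M : Matrix (Fin n₁ ⊕ Fin n₂) (Fin n₁ ⊕ Fin n₂) A)
        (_ : ∀ i j, M (Sum.inr i) (Sum.inl j) ∈ C) (v w : L),
        (w : Fin n₁ ⊕ Fin n₂ → FractionRing A) =
          (M.map (algebraMap A (FractionRing A))).mulVec v →
        π w = (M.map (residue A)).toBlocks₂₂.mulVec (π v) := by
  have hinj : Function.Injective (LinearMap.toSpanSingleton A (FractionRing A) β) := by
    intro a b hab
    simp only [LinearMap.toSpanSingleton_apply, Algebra.smul_def] at hab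
    exact IsFractionRing.injective A (FractionRing A) (β.isUnit.mul_right_cancel hab)
  set e := LinearEquiv.ofInjective _ hinj with he
  have hmem : ∀ (v : L) (j : Fin n₂), (v : Fin n₁ ⊕ Fin n₂ → FractionRing A) (Sum.inr j) ∈
      LinearMap.range (LinearMap.toSpanSingleton A (FractionRing A) β) := fun v j => by
    rw [LinearMap.range_toSpanSingleton, ← hβ j]
    exact hL.mem_iff.1 v.2 _
  let π : L →ₗ[A] (Fin n₂ → ResidueField A) :=
    { toFun := fun v j => residue A (e.symm ⟨_, hmem v j⟩)
      map_add' := fun v w => by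
        funext j
        change residue A (e.symm (⟨_, hmem v j⟩ + ⟨_, hmem w j⟩)) = _
        rw [map_add, map_add]
        rfl
      map_smul' := fun c v => by
        funext j
        change residue A (e.symm (c • ⟨_, hmem v j⟩)) = _
        rw [map_smul, smul_eq_mul, map_mul]
        rfl }
  have hπ : ∀ (v : L) (j : Fin n₂) (b : A),
      (v : Fin n₁ ⊕ Fin n₂ → FractionRing A) (Sum.inr j) = b • (β : FractionRing A) →
        π v j = residue A b := by
    intro v j b hb
    change residue A (e.symm ⟨_, hmem v j⟩) = _
    congr 1
    rw [LinearEquiv.symm_apply_eq]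
    exact Subtype.ext hb
  refine ⟨π, fun w => ?_, fun M hM v w hw => ?_⟩
  · choose b hb using fun j => residue_surjective (w j)
    refine ⟨⟨Sum.elim 0 fun j => b j • (β : FractionRing A), hL.mem_iff.2 ?_⟩, ?_⟩
    · rintro (i | j)
      · exact zero_mem _
      · rw [hβ]
        exact Submodule.smul_mem _ _ (Submodule.mem_span_singleton_self _)
    · funext j
      rw [hπ _ j (b j) rfl, hb]
  · have hvα : ∀ i, ∃ a : A, a • (α : FractionRing A) =
        (v : Fin n₁ ⊕ Fin n₂ → FractionRing A) (Sum.inl i) :=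
      fun i => Submodule.mem_span_singleton.1 (hα i ▸ hL.mem_iff.1 v.2 _)
    have hvβ : ∀ i, ∃ a : A, a • (β : FractionRing A) =
        (v : Fin n₁ ⊕ Fin n₂ → FractionRing A) (Sum.inr i) :=
      fun i => Submodule.mem_span_singleton.1 (hβ i ▸ hL.mem_iff.1 v.2 _)
    choose a ha using hvα
    choose b hb using hvβ
    choose r hrm hr using fun i j => hC _ (hM i j)
    funext j
    rw [hπ w j (∑ i, a i * r j i + ∑ l, M (Sum.inr j) (Sum.inr l) * b l)]
    · rw [map_add, map_sum, map_sum, Finset.sum_eq_zero, zero_add]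
      · refine Finset.sum_congr rfl fun l _ => ?_
        rw [map_mul, hπ v l (b l) (hb l).symm]
        rfl
      · intro i _
        rw [map_mul, (residue_eq_zero_iff _).2 (hrm j i), mul_zero]
    · rw [hw, Matrix.mulVec, dotProduct, Fintype.sum_sum_type, add_smul, Finset.sum_smul,
        Finset.sum_smul]
      congr 1
      · refine Finset.sum_congr rfl fun i _ => ?_
        rw [mul_smul, ← hr, ← ha, Matrix.map_apply, ← Algebra.smul_def, smul_comm]
      · refine Finset.sum_congr rfl fun l _ => ?_
        rw [mul_smul, hb, Matrix.map_apply, ← Algebra.smul_def]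

end Quotient

section Conjugation

open IsLocalRing

variable {G : Type u} [Group G] {A : Type u} [CommRing A] {n₁ n₂ : ℕ}
  {ρ : A[G] →ₐ[A] Matrix (Fin n₁ ⊕ Fin n₂) (Fin n₁ ⊕ Fin n₂) A}

theorem mulVec_mem_subrepresentation (L : Subrepresentation (fracRep ρ)) (x : A[G])
    {v : Fin n₁ ⊕ Fin n₂ → FractionRing A} (hv : v ∈ L.toSubmodule) :
    ((ρ x).map (algebraMap A (FractionRing A))).mulVec v ∈ L.toSubmodule := by
  induction x using MonoidAlgebra.induction_linear with
  | zero =>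
    rw [map_zero, Matrix.map_zero _ (map_zero _), Matrix.zero_mulVec]
    exact zero_mem _
  | add x y hx hy =>
    rw [map_add, Matrix.map_add _ (map_add _), Matrix.add_mulVec]
    exact add_mem hx hy
  | single g c =>
    rw [show (MonoidAlgebra.single g c : A[G]) = c • MonoidAlgebra.of A G g by simp, map_smul,
      Matrix.map_smul' _ c _ (map_mul _), Matrix.smul_mulVec, algebraMap_smul]
    exact L.toSubmodule.smul_mem c (L.apply_mem_toSubmodule g hv)

variable {P Q : Matrix (Fin n₁ ⊕ Fin n₂) (Fin n₁ ⊕ Fin n₂) A} {hPQ : P * Q = 1} {hQP : Q * P = 1}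
  {C : Ideal A}

theorem map_mul_map_eq_one {P Q : Matrix (Fin n₁ ⊕ Fin n₂) (Fin n₁ ⊕ Fin n₂) A}
    (h : P * Q = 1) : P.map (algebraMap A (FractionRing A)) *
      Q.map (algebraMap A (FractionRing A)) = 1 := by
  rw [← Matrix.map_mul, h, Matrix.map_one _ (map_zero _) (map_one _)]

theorem map_conjHom_mulVec (x : A[G]) (v : Fin n₁ ⊕ Fin n₂ → FractionRing A) :
    ((conjHom ρ hPQ hQP x).map (algebraMap A (FractionRing A))).mulVec
        ((Q.map (algebraMap A (FractionRing A))).mulVec v) =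
      (Q.map (algebraMap A (FractionRing A))).mulVec
        (((ρ x).map (algebraMap A (FractionRing A))).mulVec v) := by
  rw [Matrix.mulVec_mulVec, Matrix.mulVec_mulVec, ← Matrix.map_mul, ← Matrix.map_mul,
    conjHom_apply, mul_assoc, mul_assoc, hPQ, mul_one]

variable [IsLocalRing A] {τ₁ : G →* GL (Fin n₁) (ResidueField A)}
  {τ₂ : G →* GL (Fin n₂) (ResidueField A)}

/-- If `𝒯/𝔪𝒯` is at most one-dimensional for some Urban lattice, the ideal `C` is principal:
the coordinate lattices are `A α` and `A β`, and `C α = A β` as otherwise there would be a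
quotient isomorphic to `τ₂`. -/
theorem UrbanLattice.isPrincipal [IsNoetherianRing A] (𝓛 : UrbanLattice ρ τ₁ τ₂)
    (h : IsStandard (conjHom ρ hPQ hQP) τ₁ τ₂ C) (hn₁ : 0 < n₁) (hn₂ : 0 < n₂)
    (hw : Module.finrank (ResidueField A) (ResidueField A ⊗[A] 𝓛.𝒯) ≤ 1) : C.IsPrincipal := by
  have hlat := 𝓛.isLattice_L
  set q := Matrix.toLin' (Q.map (algebraMap A (FractionRing A))) with hq
  have hqinj : Function.Injective (q.restrictScalars A) := fun v w hvw => by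
    have h1 := congrArg (P.map (algebraMap A (FractionRing A))).mulVec hvw
    simpa [hq, map_mul_map_eq_one hPQ] using h1
  have hqsurj : Function.Surjective q := fun v =>
    ⟨(P.map (algebraMap A (FractionRing A))).mulVec v, by
      simp [hq, map_mul_map_eq_one hQP]⟩
  set L' := 𝓛.L.toSubmodule.map (q.restrictScalars A) with hL'
  have hst : IsStableLattice C L' := by
    rintro M hM _ ⟨v, hv, rfl⟩
    obtain ⟨x, rfl⟩ := h.exists_apply_eq M hM
    exact ⟨_, mulVec_mem_subrepresentation 𝓛.L x hv, (map_conjHom_mulVec x v).symm⟩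
  let E := Submodule.equivMapOfInjective (q.restrictScalars A) hqinj 𝓛.L.toSubmodule
  have hspan : Submodule.span (FractionRing A)
      (L' : Set (Fin n₁ ⊕ Fin n₂ → FractionRing A)) = ⊤ := by
    have h1 : (L' : Set (Fin n₁ ⊕ Fin n₂ → FractionRing A)) = q '' 𝓛.L.toSubmodule := rfl
    rw [h1, ← Submodule.map_span, hlat.span_eq_top, Submodule.map_top]
    exact LinearMap.range_eq_top.2 hqsurj
  have hrank : Module.finrank (ResidueField A) (ResidueField A ⊗[A] L') ≤ n₁ + n₂ := by
    rw [← LinearEquiv.finrank_eq (E.baseChange A (ResidueField A) _ _), 𝓛.finrank_reduction]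
    nlinarith
  obtain ⟨α, β, hα, hβ⟩ := hst.exists_coordLattice_eq hn₁ hn₂ (hlat.fg.map _) hspan hrank
  have hC : ∀ c ∈ C, ∃ r : A, c • (α : FractionRing A) = r • (β : FractionRing A) := by
    intro c hc
    have h1 : c • (α : FractionRing A) ∈ coordLattice L' (Sum.inr ⟨0, hn₂⟩) :=
      hst.smul_mem_coordLattice (j := Sum.inl ⟨0, hn₁⟩) (fun _ _ _ _ => hc)
        (by rw [hα]; exact Submodule.mem_span_singleton_self _)
    rw [hβ, Submodule.mem_span_singleton] at h1
    obtain ⟨r, hr⟩ := h1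
    exact ⟨r, hr.symm⟩
  by_contra hnp
  obtain ⟨π, hπs, hπ⟩ := hst.exists_quotient hα hβ fun c hc => by
    obtain ⟨r, hr⟩ := hC c hc
    refine ⟨r, (mem_maximalIdeal r).2 fun hu => hnp (isPrincipal_of_smul_eq hC hc hu hr), hr⟩
  refine 𝓛.no_quotient ⟨π.comp E.toLinearMap, hπs.comp E.surjective, fun g v => ?_⟩
  change π (E (𝓛.L.toRepresentation g v)) = (τ₂ g : Matrix _ _ _).mulVec (π (E v))
  rw [hπ (conjHom ρ hPQ hQP (MonoidAlgebra.of A G g)) (h.apply_mem _) (E v) _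
    (map_conjHom_mulVec _ _).symm]
  obtain ⟨b, hb⟩ := h.hasReduction g
  rw [hb, Matrix.toBlocks_fromBlocks₂₂]

end Conjugation

/-! ### Existence of Urban lattices -/

section StandardLattice

open IsLocalRing

variable {A : Type u} [CommRing A] {n₁ n₂ : ℕ}

/-- The module `A^n₁ × C^n₂` of column vectors. -/
def stdModule (n₁ n₂ : ℕ) (C : Ideal A) : Submodule A (Fin n₁ ⊕ Fin n₂ → A) where
  carrier := {u | ∀ j, u (Sum.inr j) ∈ C}
  add_mem' hu hv j := C.add_mem (hu j) (hv j)
  zero_mem' _ := C.zero_mem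
  smul_mem' c _ hu j := C.mul_mem_left c (hu j)

theorem single_inr_mem_stdModule {C : Ideal A} (j : Fin n₂) {c : A} (hc : c ∈ C) :
    (Pi.single (Sum.inr j) c : Fin n₁ ⊕ Fin n₂ → A) ∈ stdModule n₁ n₂ C := fun i => by
  by_cases h : i = j
  · subst h
    simpa using hc
  · rw [Pi.single_eq_of_ne (by simpa using h)]
    exact C.zero_mem

theorem single_inl_mem_stdModule {C : Ideal A} (i : Fin n₁) (c : A) :
    (Pi.single (Sum.inl i) c : Fin n₁ ⊕ Fin n₂ → A) ∈ stdModule n₁ n₂ C := fun j => by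
  rw [Pi.single_eq_of_ne (by simp)]
  exact C.zero_mem

/-- The map `u ↦ P u` into the column vectors over the total ring of fractions. -/
def embed {ι : Type*} [Fintype ι] [DecidableEq ι] (P : Matrix ι ι A) :
    (ι → A) →ₗ[A] (ι → FractionRing A) :=
  ((Algebra.linearMap A (FractionRing A)).compLeft ι).comp (Matrix.toLin' P)

theorem embed_apply {ι : Type*} [Fintype ι] [DecidableEq ι] (P : Matrix ι ι A) (u : ι → A) :
    embed P u = algebraMap A (FractionRing A) ∘ P.mulVec u := rfl

theorem embed_injective {ι : Type*} [Fintype ι] [DecidableEq ι] {P Q : Matrix ι ι A}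
    (hQP : Q * P = 1) : Function.Injective (embed P) := fun u v huv => by
  have h1 : P.mulVec u = P.mulVec v := funext fun i =>
    IsFractionRing.injective A (FractionRing A) (congrFun huv i)
  have h2 := congrArg Q.mulVec h1
  simpa [hQP] using h2

theorem embed_eq_mulVec {ι : Type*} [Fintype ι] [DecidableEq ι] (P : Matrix ι ι A) (u : ι → A) :
    embed P u =
      (P.map (algebraMap A (FractionRing A))).mulVec (algebraMap A (FractionRing A) ∘ u) :=
  funext fun i => RingHom.map_mulVec (algebraMap A (FractionRing A)) P u i

theorem mulVec_embed {ι : Type*} [Fintype ι] [DecidableEq ι] (M P : Matrix ι ι A) (u : ι → A) :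
    (M.map (algebraMap A (FractionRing A))).mulVec (embed P u) = embed (M * P) u := by
  rw [embed_eq_mulVec, embed_eq_mulVec, Matrix.mulVec_mulVec, ← Matrix.map_mul]

/-- The lattice `P (A^n₁ × C^n₂)`. -/
def stdLattice (P : Matrix (Fin n₁ ⊕ Fin n₂) (Fin n₁ ⊕ Fin n₂) A) (C : Ideal A) :
    Submodule A (Fin n₁ ⊕ Fin n₂ → FractionRing A) :=
  (stdModule n₁ n₂ C).map (embed P)

/-- The ideal `C`, as a submodule of the total ring of fractions. -/
def fracIdeal (C : Ideal A) : Submodule A (FractionRing A) :=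
  Submodule.map (Algebra.linearMap A (FractionRing A)) C

/-- The identification of `C` with its image in the total ring of fractions. -/
def fracIdealEquiv (C : Ideal A) : C ≃ₗ[A] fracIdeal C :=
  Submodule.equivMapOfInjective (Algebra.linearMap A (FractionRing A))
    (IsFractionRing.injective A (FractionRing A)) C

variable [IsNoetherianRing A] {C : Ideal A}

theorem isLattice_fracIdeal (hC : C.map (algebraMap A (FractionRing A)) = ⊤) :
    Submodule.IsLattice (FractionRing A) (fracIdeal C) where
  fg := (IsNoetherian.noetherian C).map _
  span_eq_top := hC

theorem isLattice_stdLattice {P Q : Matrix (Fin n₁ ⊕ Fin n₂) (Fin n₁ ⊕ Fin n₂) A}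
    (hPQ : P * Q = 1) (hC : C.map (algebraMap A (FractionRing A)) = ⊤) :
    Submodule.IsLattice (FractionRing A) (stdLattice P C) where
  fg := (IsNoetherian.noetherian _).map _
  span_eq_top := by
    set S := Submodule.span (FractionRing A)
      (stdLattice P C : Set (Fin n₁ ⊕ Fin n₂ → FractionRing A)) with hS
    set p := Matrix.toLin' (P.map (algebraMap A (FractionRing A))) with hp
    have h1 : ∀ i, (LinearMap.single (FractionRing A) (fun _ => FractionRing A) i).range ≤
        S.comap p := by
      intro i
      have h2 : ∀ c ∈ C, p (Pi.single i (algebraMap A (FractionRing A) c)) ∈ S := fun c hc => by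
        refine Submodule.subset_span ⟨Pi.single i c, fun j => ?_, ?_⟩
        · by_cases h : Sum.inr j = i
          · subst h
            simpa using hc
          · rw [Pi.single_eq_of_ne h]
            exact C.zero_mem
        · rw [embed_eq_mulVec]
          refine congrArg _ (funext fun j => ?_)
          rw [Function.comp_apply, Pi.apply_single (fun _ => algebraMap A (FractionRing A))
            (fun _ => map_zero _)]
      have h3 : C.map (algebraMap A (FractionRing A)) ≤ (S.comap p).comap
          (LinearMap.single (FractionRing A) (fun _ => FractionRing A) i) :=
        Ideal.span_le.2 (by rintro _ ⟨c, hc, rfl⟩; exact h2 c hc)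
      rw [hC] at h3
      rintro _ ⟨t, rfl⟩
      exact h3 trivial
    refine top_le_iff.1 fun v _ => ?_
    have h4 : (Q.map (algebraMap A (FractionRing A))).mulVec v ∈ S.comap p := by
      rw [← Finset.univ_sum_single ((Q.map (algebraMap A (FractionRing A))).mulVec v)]
      exact sum_mem fun i _ => h1 i ⟨_, rfl⟩
    simpa [hp, map_mul_map_eq_one hPQ] using h4

end StandardLattice

section StandardSequence

open IsLocalRing

variable {A : Type u} [CommRing A] {n₁ n₂ : ℕ} {C : Ideal A}
  {P Q : Matrix (Fin n₁ ⊕ Fin n₂) (Fin n₁ ⊕ Fin n₂) A} (hQP : Q * P = 1)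

/-- The identification of `A^n₁ × C^n₂` with the standard lattice. -/
def stdEquiv (C : Ideal A) : stdModule n₁ n₂ C ≃ₗ[A] stdLattice P C :=
  Submodule.equivMapOfInjective (embed P) (embed_injective hQP) _

/-- The inclusion of `C` in the standard lattice at the `j`-th of the last `n₂` coordinates. -/
def stdIncl (C : Ideal A) (j : Fin n₂) : fracIdeal C →ₗ[A] stdLattice P C :=
  (stdEquiv hQP C).toLinearMap.comp
    (((LinearMap.single A (fun _ => A) (Sum.inr j)).comp
        (C.subtype.comp (fracIdealEquiv C).symm.toLinearMap)).codRestrict (stdModule n₁ n₂ C)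
      fun t => single_inr_mem_stdModule j ((fracIdealEquiv C).symm t).2)

/-- The `j`-th of the last `n₂` coordinates on the standard lattice. -/
def stdCoord (C : Ideal A) (j : Fin n₂) : stdLattice P C →ₗ[A] fracIdeal C :=
  (fracIdealEquiv C).toLinearMap.comp
    ((((LinearMap.proj (Sum.inr j)).comp (stdModule n₁ n₂ C).subtype).codRestrict C
      fun u => u.2 j).comp (stdEquiv hQP C).symm.toLinearMap)

/-- The `i`-th of the first `n₁` vectors of the basis of the standard lattice. -/
def stdVec (C : Ideal A) (i : Fin n₁) : stdLattice P C :=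
  stdEquiv hQP C ⟨Pi.single (Sum.inl i) 1, single_inl_mem_stdModule i 1⟩

theorem stdCoord_stdEquiv (u : stdModule n₁ n₂ C) (j : Fin n₂) :
    stdCoord hQP C j (stdEquiv hQP C u) =
      fracIdealEquiv C ⟨(u : Fin n₁ ⊕ Fin n₂ → A) (Sum.inr j), u.2 j⟩ := by
  simp [stdCoord]
  rfl

theorem stdIncl_fracIdealEquiv (j : Fin n₂) (c : C) :
    stdIncl hQP C j (fracIdealEquiv C c) =
      stdEquiv hQP C ⟨Pi.single (Sum.inr j) (c : A), single_inr_mem_stdModule j c.2⟩ := by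
  refine congrArg (stdEquiv hQP C) (Subtype.ext ?_)
  change (Pi.single (Sum.inr j) (((fracIdealEquiv C).symm (fracIdealEquiv C c) : C) : A) :
    Fin n₁ ⊕ Fin n₂ → A) = _
  rw [LinearEquiv.symm_apply_apply]

/-- The decomposition of an element of the standard lattice along its coordinates. -/
theorem stdEquiv_eq_sum (u : stdModule n₁ n₂ C) :
    stdEquiv hQP C u = ∑ j, stdIncl hQP C j (stdCoord hQP C j (stdEquiv hQP C u)) +
      ∑ i, (u : Fin n₁ ⊕ Fin n₂ → A) (Sum.inl i) • stdVec hQP C i := by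
  simp_rw [stdCoord_stdEquiv, stdIncl_fracIdealEquiv, stdVec, ← map_smul, ← map_sum, ← map_add]
  refine congrArg _ (Subtype.ext ?_)
  rw [Submodule.coe_add, AddSubmonoidClass.coe_finsetSum, AddSubmonoidClass.coe_finsetSum,
    add_comm]
  conv_lhs => rw [← Finset.univ_sum_single (u : Fin n₁ ⊕ Fin n₂ → A)]
  rw [Fintype.sum_sum_type]
  congr 1
  refine Finset.sum_congr rfl fun i _ => ?_
  rw [Submodule.coe_smul, ← Pi.single_smul, smul_eq_mul, mul_one]

theorem stdCoord_stdIncl (l j : Fin n₂) (t : fracIdeal C) :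
    stdCoord hQP C l (stdIncl hQP C j t) = if l = j then t else 0 := by
  obtain ⟨c, rfl⟩ := (fracIdealEquiv C).surjective t
  rw [stdIncl_fracIdealEquiv, stdCoord_stdEquiv]
  split_ifs with h
  · subst h
    simp
  · rw [← map_zero (fracIdealEquiv C)]
    refine congrArg _ (Subtype.ext ?_)
    exact Pi.single_eq_of_ne (by simpa using h) _

variable [IsLocalRing A]

/-- The reduction of the first `n₁` coordinates on the standard lattice. -/
def stdProj (C : Ideal A) : stdLattice P C →ₗ[A] (Fin n₁ → ResidueField A) :=
  (LinearMap.pi fun i => (Algebra.linearMap A (ResidueField A)).comp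
    ((LinearMap.proj (Sum.inl i)).comp (stdModule n₁ n₂ C).subtype)).comp
      (stdEquiv hQP C).symm.toLinearMap

theorem stdProj_stdEquiv (u : stdModule n₁ n₂ C) (i : Fin n₁) :
    stdProj hQP C (stdEquiv hQP C u) i = residue A ((u : Fin n₁ ⊕ Fin n₂ → A) (Sum.inl i)) := by
  simp [stdProj]

theorem stdProj_stdIncl (j : Fin n₂) (t : fracIdeal C) :
    stdProj hQP C (stdIncl hQP C j t) = 0 := by
  obtain ⟨c, rfl⟩ := (fracIdealEquiv C).surjective t
  rw [stdIncl_fracIdealEquiv]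
  funext i
  rw [stdProj_stdEquiv]
  simp

/-- The map `k^n₂ ⊗ C/𝔪C → k ⊗ L` for the standard lattice `L`. -/
def redIncl (C : Ideal A) :
    (Fin n₂ → ResidueField A) ⊗[ResidueField A] (ResidueField A ⊗[A] fracIdeal C)
      →ₗ[ResidueField A] ResidueField A ⊗[A] stdLattice P C :=
  TensorProduct.lift
    (∑ j, (LinearMap.proj j).smulRight ((stdIncl hQP C j).baseChange (ResidueField A)))

theorem redIncl_tmul (v : Fin n₂ → ResidueField A) (y : ResidueField A ⊗[A] fracIdeal C) :
    redIncl hQP C (v ⊗ₜ y) = ∑ j, v j • (stdIncl hQP C j).baseChange (ResidueField A) y := by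
  simp [redIncl, LinearMap.sum_apply]

/-- The map `k ⊗ L → k^n₁` for the standard lattice `L`. -/
def redProj (C : Ideal A) :
    ResidueField A ⊗[A] stdLattice P C →ₗ[ResidueField A] (Fin n₁ → ResidueField A) :=
  (stdProj hQP C).liftBaseChange (ResidueField A)

theorem redProj_one_tmul (w : stdLattice P C) :
    redProj hQP C (1 ⊗ₜ w) = stdProj hQP C w := by
  simp [redProj]

theorem one_tmul_eq_sum (w : stdLattice P C) : (1 : ResidueField A) ⊗ₜ[A] w =
    ∑ j, (1 : ResidueField A) ⊗ₜ[A] stdIncl hQP C j (stdCoord hQP C j w) +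
      ∑ i, stdProj hQP C w i • (1 : ResidueField A) ⊗ₜ[A] stdVec hQP C i := by
  obtain ⟨u, rfl⟩ := (stdEquiv hQP C).surjective w
  conv_lhs => rw [stdEquiv_eq_sum]
  rw [TensorProduct.tmul_add, TensorProduct.tmul_sum, TensorProduct.tmul_sum]
  congr 1
  refine Finset.sum_congr rfl fun i _ => ?_
  rw [stdProj_stdEquiv, TensorProduct.tmul_smul]
  exact (algebraMap_smul (ResidueField A) _ _).symm

/-- The coordinate maps `stdCoord` give a retraction of `redIncl`. -/
theorem redIncl_injective : Function.Injective (redIncl (n₁ := n₁) (n₂ := n₂) hQP C) := by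
  let R : ResidueField A ⊗[A] stdLattice P C →ₗ[ResidueField A]
      (Fin n₂ → ResidueField A) ⊗[ResidueField A] (ResidueField A ⊗[A] fracIdeal C) :=
    ∑ l, (TensorProduct.mk (ResidueField A) _ _ (Pi.single l 1)).comp
      ((stdCoord hQP C l).baseChange (ResidueField A))
  have hR : R.comp (redIncl hQP C) = LinearMap.id := by
    refine TensorProduct.ext' fun v y => ?_
    rw [LinearMap.comp_apply, redIncl_tmul, LinearMap.id_apply, map_sum]
    have h1 : ∀ j, R ((stdIncl hQP C j).baseChange (ResidueField A) y) =
        Pi.single j 1 ⊗ₜ y := fun j => by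
      obtain ⟨t, rfl⟩ := one_tmul_surjective y
      simp only [R, LinearMap.sum_apply, LinearMap.comp_apply, LinearMap.baseChange_tmul,
        stdCoord_stdIncl]
      rw [Finset.sum_eq_single j]
      · rw [if_pos rfl, TensorProduct.mk_apply]
      · intro l _ hl
        rw [if_neg hl, TensorProduct.tmul_zero, map_zero]
      · simp
    simp_rw [map_smul, h1, TensorProduct.smul_tmul', ← TensorProduct.sum_tmul]
    congr 1
    funext l
    simp [Finset.sum_apply, Pi.single_apply]
  exact Function.LeftInverse.injective (g := R) fun x => LinearMap.congr_fun hR x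

theorem redIncl_redProj_exact :
    Function.Exact (redIncl (n₁ := n₁) (n₂ := n₂) hQP C) (redProj hQP C) := by
  intro x
  constructor
  · intro hx
    obtain ⟨w, rfl⟩ := one_tmul_surjective x
    rw [redProj_one_tmul] at hx
    refine ⟨∑ j, Pi.single j 1 ⊗ₜ ((1 : ResidueField A) ⊗ₜ[A] stdCoord hQP C j w), ?_⟩
    rw [map_sum, one_tmul_eq_sum hQP w, hx]
    simp [redIncl_tmul, Pi.single_apply]
  · rintro ⟨y, rfl⟩
    induction y using TensorProduct.induction_on with
    | zero => simp
    | tmul v y =>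
      obtain ⟨t, rfl⟩ := one_tmul_surjective y
      rw [redIncl_tmul, map_sum]
      refine Finset.sum_eq_zero fun j _ => ?_
      rw [map_smul, LinearMap.baseChange_tmul, redProj_one_tmul, stdProj_stdIncl, smul_zero]
    | add y z hy hz => rw [map_add, map_add, hy, hz, add_zero]

theorem redProj_surjective :
    Function.Surjective (redProj (n₁ := n₁) (n₂ := n₂) hQP C) := fun w => by
  choose a ha using fun i => residue_surjective (w i)
  refine ⟨1 ⊗ₜ stdEquiv hQP C ⟨Sum.elim a 0, fun j => C.zero_mem⟩, ?_⟩
  rw [redProj_one_tmul]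
  funext i
  rw [stdProj_stdEquiv, ← ha i]
  rfl

end StandardSequence

section StandardUrbanLattice

open IsLocalRing

variable {G : Type u} [Group G] {A : Type u} [CommRing A] {n₁ n₂ : ℕ} {C : Ideal A}

theorem mulVec_mem_stdModule {M : Matrix (Fin n₁ ⊕ Fin n₂) (Fin n₁ ⊕ Fin n₂) A}
    (hM : ∀ i j, M (Sum.inr i) (Sum.inl j) ∈ C) (u : stdModule n₁ n₂ C) :
    M.mulVec u ∈ stdModule n₁ n₂ C := fun j => by
  rw [Matrix.mulVec, dotProduct, Fintype.sum_sum_type]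
  exact C.add_mem (sum_mem fun i _ => C.mul_mem_right _ (hM j i))
    (sum_mem fun i _ => C.mul_mem_left _ (u.2 i))

variable {ρ : A[G] →ₐ[A] Matrix (Fin n₁ ⊕ Fin n₂) (Fin n₁ ⊕ Fin n₂) A}
  {P Q : Matrix (Fin n₁ ⊕ Fin n₂) (Fin n₁ ⊕ Fin n₂) A} {hPQ : P * Q = 1} {hQP : Q * P = 1}

theorem map_mulVec_embed (x : A[G]) (u : Fin n₁ ⊕ Fin n₂ → A) :
    ((ρ x).map (algebraMap A (FractionRing A))).mulVec (embed P u) =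
      embed P ((conjHom ρ hPQ hQP x).mulVec u) := by
  rw [mulVec_embed, embed_apply, embed_apply, Matrix.mulVec_mulVec, conjHom_apply, mul_assoc,
    ← mul_assoc P, hPQ, one_mul]

variable [IsLocalRing A] {τ₁ : G →* GL (Fin n₁) (ResidueField A)}
  {τ₂ : G →* GL (Fin n₂) (ResidueField A)} (h : IsStandard (conjHom ρ hPQ hQP) τ₁ τ₂ C)

/-- An endomorphism that acts on the `n₂` copies of `C/𝔪C` through the matrix `B` restricts to
`B ⊗ 1` along `redIncl`. -/
theorem redIncl_map
    (Φ : Module.End (ResidueField A) (ResidueField A ⊗[A] stdLattice P C))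
    {B : Matrix (Fin n₂) (Fin n₂) (ResidueField A)}
    (hΦ : ∀ j (t : fracIdeal C), Φ ((1 : ResidueField A) ⊗ₜ[A] stdIncl hQP C j t) =
      ∑ l, B l j • (1 : ResidueField A) ⊗ₜ[A] stdIncl hQP C l t)
    (x : (Fin n₂ → ResidueField A) ⊗[ResidueField A] (ResidueField A ⊗[A] fracIdeal C)) :
    redIncl hQP C (TensorProduct.map (Matrix.toLin' B) LinearMap.id x) = Φ (redIncl hQP C x) := by
  induction x using TensorProduct.induction_on with
  | zero => simp only [map_zero]
  | add x y hx hy => simp only [map_add, hx, hy]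
  | tmul v y =>
    obtain ⟨t, rfl⟩ := one_tmul_surjective y
    rw [TensorProduct.map_tmul, redIncl_tmul, redIncl_tmul, map_sum]
    simp only [LinearMap.baseChange_tmul, map_smul, hΦ, LinearMap.id_apply, Finset.smul_sum]
    rw [Finset.sum_comm]
    refine Finset.sum_congr rfl fun l _ => ?_
    simp only [Matrix.toLin'_apply, Matrix.mulVec, dotProduct, Finset.sum_smul]
    exact Finset.sum_congr rfl fun j _ => by rw [mul_comm, mul_smul]

/-- The standard lattice as a subrepresentation. -/
def stdSubrep : Subrepresentation (fracRep ρ) where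
  toSubmodule := stdLattice P C
  apply_mem_toSubmodule g v hv := by
    obtain ⟨u, hu, rfl⟩ := hv
    exact ⟨_, mulVec_mem_stdModule (h.apply_mem (MonoidAlgebra.of A G g)) ⟨u, hu⟩,
      (map_mulVec_embed (hPQ := hPQ) (hQP := hQP) _ u).symm⟩

theorem stdSubrep_apply (g : G) (u : stdModule n₁ n₂ C) :
    (stdSubrep h).toRepresentation g (stdEquiv hQP C u) =
      stdEquiv hQP C ⟨_, mulVec_mem_stdModule (h.apply_mem (MonoidAlgebra.of A G g)) u⟩ :=
  Subtype.ext (map_mulVec_embed (hPQ := hPQ) (hQP := hQP) (MonoidAlgebra.of A G g)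
    (u : Fin n₁ ⊕ Fin n₂ → A))

theorem residualRep_one_tmul {V : Type u} [AddCommGroup V] [Module A V] (σ : Representation A G V)
    (g : G) (v : V) :
    residualRep σ g ((1 : ResidueField A) ⊗ₜ[A] v) = (1 : ResidueField A) ⊗ₜ[A] σ g v := rfl

theorem redProj_residualRep (hn₁ : 0 < n₁) (hn₂ : 0 < n₂) (g : G)
    (x : ResidueField A ⊗[A] stdLattice P C) :
    redProj hQP C (residualRep (stdSubrep h).toRepresentation g x) =
      vecRep τ₁ g (redProj hQP C x) := by
  obtain ⟨w, rfl⟩ := one_tmul_surjective x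
  obtain ⟨u, rfl⟩ := (stdEquiv hQP C).surjective w
  refine (redProj_one_tmul hQP _).trans ?_
  rw [stdSubrep_apply, redProj_one_tmul]
  obtain ⟨b, hb⟩ := h.hasReduction g
  funext i
  rw [stdProj_stdEquiv, vecRep_apply]
  simp only [Matrix.mulVec, dotProduct]
  rw [Fintype.sum_sum_type, map_add, map_sum, map_sum, add_eq_left.2]
  · refine Finset.sum_congr rfl fun j _ => ?_
    rw [map_mul, stdProj_stdEquiv]
    congr 1
    exact congrFun (congrFun hb (Sum.inl i)) (Sum.inl j)
  · refine Finset.sum_eq_zero fun j _ => ?_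
    rw [map_mul, (residue_eq_zero_iff _).2 (h.le_maximalIdeal hn₁ hn₂ (u.2 j)), mul_zero]

theorem redIncl_tprod (hn₁ : 0 < n₁) (hn₂ : 0 < n₂) (g : G)
    (x : (Fin n₂ → ResidueField A) ⊗[ResidueField A] (ResidueField A ⊗[A] fracIdeal C)) :
    redIncl hQP C ((vecRep τ₂).tprod (Representation.trivial (ResidueField A) G
        (ResidueField A ⊗[A] fracIdeal C)) g x) =
      residualRep (stdSubrep h).toRepresentation g (redIncl hQP C x) := by
  obtain ⟨b, hb⟩ := h.hasReduction g
  -- modulo `𝔪`, an element `c` of `C` at the `j`-th coordinate goes to the multiples of `c` by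
  -- the `j`-th column of `τ₂ g`
  have h1 : ∀ j (t : fracIdeal C), residualRep (stdSubrep h).toRepresentation g
      ((1 : ResidueField A) ⊗ₜ[A] stdIncl hQP C j t) =
        ∑ l, (τ₂ g : Matrix (Fin n₂) (Fin n₂) (ResidueField A)) l j •
          (1 : ResidueField A) ⊗ₜ[A] stdIncl hQP C l t := by
    intro j t
    obtain ⟨c, rfl⟩ := (fracIdealEquiv C).surjective t
    refine (residualRep_one_tmul _ g _).trans ?_
    rw [stdIncl_fracIdealEquiv, stdSubrep_apply]
    refine (one_tmul_eq_sum hQP _).trans ?_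
    rw [add_eq_left.2]
    · refine Finset.sum_congr rfl fun l _ => ?_
      rw [stdCoord_stdEquiv, ← show _ = (τ₂ g : Matrix (Fin n₂) (Fin n₂) (ResidueField A)) l j from
        congrFun (congrFun hb (Sum.inr l)) (Sum.inr j), Matrix.map_apply,
        ← IsLocalRing.ResidueField.algebraMap_eq, algebraMap_smul, ← TensorProduct.tmul_smul,
        ← map_smul, ← map_smul]
      congr 3
      refine Subtype.ext ?_
      simp
    · refine Finset.sum_eq_zero fun i _ => ?_
      rw [stdProj_stdEquiv]
      simp [(residue_eq_zero_iff _).2 (h.le_maximalIdeal hn₁ hn₂ c.2)]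
  exact redIncl_map (residualRep (stdSubrep h).toRepresentation g) h1 x

/-- The standard lattice has no quotient isomorphic to `τ₂`: every element of it is the image
of its first basis vector under some `M = ρ(x)` whose lower right block vanishes. -/
theorem stdSubrep_no_quotient (hn₁ : 0 < n₁) (hn₂ : 0 < n₂) :
    ¬ ∃ π : (stdSubrep h).toSubmodule →ₗ[A] (Fin n₂ → ResidueField A),
      Function.Surjective π ∧
        ∀ g v, π ((stdSubrep h).toRepresentation g v) = vecRep τ₂ g (π v) := by
  rintro ⟨π, hπ, hπg⟩
  let φ : stdModule n₁ n₂ C →ₗ[A] (Fin n₂ → ResidueField A) :=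
    LinearMap.comp (M₂ := stdLattice P C) π (stdEquiv hQP C).toLinearMap
  have h1 : ∀ (x : A[G]) (u w : stdModule n₁ n₂ C),
      (w : Fin n₁ ⊕ Fin n₂ → A) = (conjHom ρ hPQ hQP x).mulVec u →
      φ w = ((conjHom ρ hPQ hQP x).map (residue A)).toBlocks₂₂.mulVec (φ u) := by
    intro x u
    induction x using MonoidAlgebra.induction_linear with
    | zero =>
      intro w hw
      rw [map_zero, Matrix.zero_mulVec] at hw
      rw [show w = 0 from Subtype.ext hw, map_zero, map_zero, Matrix.map_zero _ (map_zero _)]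
      exact (Matrix.zero_mulVec _).symm
    | add x y hx hy =>
      intro w hw
      rw [map_add, Matrix.add_mulVec] at hw
      rw [show w = ⟨_, mulVec_mem_stdModule (h.apply_mem x) u⟩ +
        ⟨_, mulVec_mem_stdModule (h.apply_mem y) u⟩ from Subtype.ext hw, map_add,
        hx ⟨_, mulVec_mem_stdModule (h.apply_mem x) u⟩ rfl,
        hy ⟨_, mulVec_mem_stdModule (h.apply_mem y) u⟩ rfl, ← Matrix.add_mulVec, map_add,
        Matrix.map_add _ (map_add _)]
      rfl
    | single g c =>
      intro w hw
      rw [show (MonoidAlgebra.single g c : A[G]) = c • MonoidAlgebra.of A G g by simp, map_smul]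
        at hw ⊢
      obtain ⟨b, hb⟩ := h.hasReduction g
      rw [Matrix.smul_mulVec] at hw
      rw [show w = c • ⟨_, mulVec_mem_stdModule (h.apply_mem (MonoidAlgebra.of A G g)) u⟩ from
        Subtype.ext hw, map_smul, Matrix.map_smul' _ c _ (map_mul _), hb]
      have h2 := hπg g (stdEquiv hQP C u)
      rw [stdSubrep_apply, vecRep_apply] at h2
      rw [show Matrix.toBlocks₂₂ (residue A c • Matrix.fromBlocks
        (τ₁ g : Matrix (Fin n₁) (Fin n₁) (ResidueField A)) b 0
        (τ₂ g : Matrix (Fin n₂) (Fin n₂) (ResidueField A))) =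
          residue A c • (τ₂ g : Matrix (Fin n₂) (Fin n₂) (ResidueField A)) from rfl,
        Matrix.smul_mulVec, ← ResidueField.algebraMap_eq, algebraMap_smul]
      exact congrArg (c • ·) h2
  have h2 : ∀ u, φ u = 0 := by
    intro u
    obtain ⟨x, hx⟩ := h.exists_apply_eq
      (Matrix.of fun i j => if j = Sum.inl ⟨0, hn₁⟩ then (u : Fin n₁ ⊕ Fin n₂ → A) i else 0)
      (fun i j => by
        rw [Matrix.of_apply]
        split_ifs
        · exact u.2 i
        · exact C.zero_mem)
    rw [h1 x ⟨Pi.single (Sum.inl ⟨0, hn₁⟩) 1, single_inl_mem_stdModule _ 1⟩ u (by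
        rw [hx, Matrix.mulVec_single_one]
        funext i
        simp),
      show ((conjHom ρ hPQ hQP x).map (residue A)).toBlocks₂₂ = 0 by
        rw [hx]
        ext i j
        simp [Matrix.toBlocks₂₂], Matrix.zero_mulVec]
  obtain ⟨w, hw⟩ := hπ fun _ => 1
  obtain ⟨u, rfl⟩ := (stdEquiv hQP C).surjective w
  exact one_ne_zero (congrFun ((h2 u).symm.trans hw) ⟨0, hn₂⟩).symm

/-- The lattice `P (A^n₁ × C^n₂)`, with `𝒯 = C`, is an Urban lattice. -/
def stdUrbanLattice [IsNoetherianRing A] (hn₁ : 0 < n₁) (hn₂ : 0 < n₂)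
    (hC : C.map (algebraMap A (FractionRing A)) = ⊤) : UrbanLattice ρ τ₁ τ₂ where
  L := stdSubrep h
  𝒯 := fracIdeal C
  isLattice_L := isLattice_stdLattice hPQ hC
  isLattice_𝒯 := isLattice_fracIdeal hC
  incl :=
    { toLinearMap := redIncl hQP C
      isIntertwining' := fun g => LinearMap.ext (redIncl_tprod h hn₁ hn₂ g) }
  proj :=
    { toLinearMap := redProj hQP C
      isIntertwining' := fun g => LinearMap.ext (redProj_residualRep h hn₁ hn₂ g) }
  isShortExact :=
    { injective := redIncl_injective hQP
      exact := redIncl_redProj_exact hQP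
      surjective := redProj_surjective hQP }
  no_quotient := stdSubrep_no_quotient h hn₁ hn₂

end StandardUrbanLattice

end RedIdeal

end

theorem theorem4p2
    (p : ℕ) [Fact p.Prime]
    (E : Type*) [Field E] [Algebra ℚ_[p] E] [FiniteDimensional ℚ_[p] E]
    [Algebra ℤ_[p] E] [IsScalarTower ℤ_[p] ℚ_[p] E]
    (A : Type u) [CommRing A] [IsLocalRing A] [IsNoetherianRing A] [IsReduced A]
    [IsAdicComplete (IsLocalRing.maximalIdeal A) A]
    [Algebra (integralClosure ℤ_[p] E) A] [Module.Finite (integralClosure ℤ_[p] E) A]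
    (hres : Function.Surjective
      (algebraMap (integralClosure ℤ_[p] E) (IsLocalRing.ResidueField A)))
    (G : Type u) [Group G] (n₁ n₂ : ℕ)
    (hn : IsUnit ((Nat.factorial (n₁ + n₂) : ℕ) : A))
    (τ₁ : G →* GL (Fin n₁) (IsLocalRing.ResidueField A))
    (τ₂ : G →* GL (Fin n₂) (IsLocalRing.ResidueField A))
    (hτ₁ : RedIdeal.IsAbsIrreducible τ₁) (hτ₂ : RedIdeal.IsAbsIrreducible τ₂)
    (hτ : IsEmpty ((RedIdeal.vecRep τ₁).Equiv (RedIdeal.vecRep τ₂)))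
    (ρ : MonoidAlgebra A G →ₐ[A] Matrix (Fin n₁ ⊕ Fin n₂) (Fin n₁ ⊕ Fin n₂) A)
    (hρ : RedIdeal.HasReduction ρ τ₁ τ₂)
    (S₁₂ : Submodule (IsLocalRing.ResidueField A)
      (RedIdeal.ExtOne (RedIdeal.vecRep τ₁) (RedIdeal.vecRep τ₂)))
    (hS₁₂ : Module.finrank (IsLocalRing.ResidueField A) S₁₂ = 1)
    (S₂₁ : Submodule (IsLocalRing.ResidueField A)
      (RedIdeal.ExtOne (RedIdeal.vecRep τ₂) (RedIdeal.vecRep τ₁)))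
    (hS₂₁ : Module.finrank (IsLocalRing.ResidueField A) S₂₁ = 1)
    (hρS : hρ.extClass ∈ S₂₁) (hρ0 : hρ.extClass ≠ 0)
    (hirr : ∀ (M : Ideal (FractionRing A)) [M.IsMaximal],
      RedIdeal.IsAbsIrreduciblePseudorep
        ((Algebra.linearMap A M.ResidueField).comp (RedIdeal.traceMap ρ))) :
    IsLeast {J | RedIdeal.IsReducibleModulo (RedIdeal.traceMap ρ) τ₁ τ₂ J}
        (RedIdeal.reducibilityIdeal (RedIdeal.traceMap ρ) τ₁ τ₂) ∧
      Nonempty (RedIdeal.UrbanLattice ρ τ₁ τ₂) ∧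
      ∀ 𝓛 : RedIdeal.UrbanLattice ρ τ₁ τ₂, Function.Injective 𝓛.ι ∧
        (Set.range 𝓛.ι ⊆ S₁₂ →
          (RedIdeal.reducibilityIdeal (RedIdeal.traceMap ρ) τ₁ τ₂).IsPrincipal) := by

  obtain ⟨P, Q, hPQ, hQP, C, h⟩ := RedIdeal.exists_isStandard_conj hn hτ₁ hτ₂ hτ hρ hρ0
  have hn₁ := hτ₁.pos
  have hn₂ := hτ₂.pos
  have hI : RedIdeal.reducibilityIdeal (RedIdeal.traceMap ρ) τ₁ τ₂ = C := by
    rw [← RedIdeal.traceMap_conjHom ρ hPQ hQP, h.reducibilityIdeal_eq hn₁ hn₂ hn]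
  have hC : C.map (algebraMap A (FractionRing A)) = ⊤ :=
    RedIdeal.map_fractionRing_eq_top hn hn₁ hn₂ h.apply_mem
      (by rwa [RedIdeal.traceMap_conjHom])
  rw [hI]
  refine ⟨⟨?_, fun J hJ => ?_⟩, ⟨RedIdeal.stdUrbanLattice h hn₁ hn₂ hC⟩,
    fun 𝓛 => ⟨𝓛.ι_injective, fun hι => ?_⟩⟩
  · rw [← RedIdeal.traceMap_conjHom ρ hPQ hQP]
    exact h.isReducibleModulo hn₁ hn₂ hn
  · rw [← RedIdeal.traceMap_conjHom ρ hPQ hQP] at hJ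
    exact h.le_of_isReducibleModulo hn₁ hn₂ hJ
  · exact 𝓛.isPrincipal h hn₁ hn₂ (𝓛.finrank_le_one hS₁₂ hι)
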